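/- Let $K_{2n}$ be the complete graph on $2n$ nodes with edge set $E_{2n}$. The SWAP algorithm for Graph Partitioning on $K_{2n}$ with edge weights $X=(X_e)_{e\in E_{2n}}$ starts from some partition $(V_1,V_2)$ of the nodes into two parts of size $n$; while there are nodes $u\in V_1$, $v\in V_2$ such that swapping them (each moves to the other part) strictly decreases the total weight of the edges between the two parts, it performs one such swap (a step). It terminates when there is no such pair. An implementation of SWAP is an arbitrary choice of the initial balanced partition together with an arbitrary pivoting rule, which selects the improving swap to be performed and may depend on the weights and on the whole history of the run. There are an absolute constant $C>0$ and a sequence $\delta_n\to 0$ such that the following holds for every $n\ge 1$, every $\phi>0$ and every family $(\mathcal X_e)_{e\in E_{2n}}$ of probability distributions on $\mathbb R$, each supported on $[-1,1]$ and having a density bounded from above by $\phi$. Let the edge weights $X_e\sim\mathcal X_e$ be drawn independently. Then: 1. with probability at least $1-\delta_n$ over the draw of $X$, every implementation of SWAP terminates within $\phi\, n^{C\log^{10} n}$ steps on $X$; 2. the expectation over $X$ of the maximum, over all implementations of SWAP, of the number of steps until termination on $X$ (a measurable function of $X$) is at most $\phi\, n^{C\log^{10} n}$. -/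

import Mathlib

open MeasureTheory Filter Topology
open scoped ENNReal

namespace SwapPartition

/-- The edges of the complete graph `K_{2n}` on the vertex set `Fin (2 * n)`. -/
abbrev Edge (n : ℕ) : Type := (⊤ : SimpleGraph (Fin (2 * n))).edgeSet

/-- Edge weights of `K_{2n}`. -/
abbrev Weights (n : ℕ) : Type := Edge n → ℝ

/-- A partition `(V₁, V₂)` of the nodes is represented by its first part `V₁`; the second part
is the complement of `V₁`. It is balanced if both parts have `n` nodes. -/
def IsBalanced {n : ℕ} (U : Finset (Fin (2 * n))) : Prop := U.card = n

/-- The edge `e` has one endpoint in `U` and the other one outside `U`. -/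
def Crosses {n : ℕ} (U : Finset (Fin (2 * n))) (e : Edge n) : Prop :=
  ∃ u v, e.1 = s(u, v) ∧ u ∈ U ∧ v ∉ U

open Classical in
/-- The weight of the cut defined by the partition `(U, Uᶜ)`. -/
noncomputable def cut {n : ℕ} (X : Weights n) (U : Finset (Fin (2 * n))) : ℝ :=
  ∑ e : Edge n, if Crosses U e then X e else 0

/-- The partition obtained when the nodes of the pair `p` are swapped: `p.1` leaves the first
part and `p.2` enters it. -/
def swapNodes {n : ℕ} (U : Finset (Fin (2 * n))) (p : Fin (2 * n) × Fin (2 * n)) :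
    Finset (Fin (2 * n)) :=
  insert p.2 (U.erase p.1)

/-- `p` consists of one node of each part, and swapping them decreases the weight of the cut. -/
def IsImprovingSwap {n : ℕ} (X : Weights n) (U : Finset (Fin (2 * n)))
    (p : Fin (2 * n) × Fin (2 * n)) : Prop :=
  p.1 ∈ U ∧ p.2 ∉ U ∧ cut X (swapNodes U p) < cut X U

/-- No swap decreases the weight of the cut. -/
def IsLocalOpt {n : ℕ} (X : Weights n) (U : Finset (Fin (2 * n))) : Prop :=
  ∀ p, ¬ IsImprovingSwap X U p

/-- An implementation of the SWAP algorithm: an initial balanced partition and a pivoting rule.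
The pivoting rule may use the weights, the list of all earlier partitions (latest first) and the
current partition; whenever there is an improving swap, it selects one of them.
A randomized implementation is one such object for each value of its random seed. -/
structure Implementation (n : ℕ) where
  /-- the initial partition -/
  init : Weights n → Finset (Fin (2 * n))
  init_balanced : ∀ X, IsBalanced (init X)
  /-- the pivoting rule -/
  pivot : Weights n → List (Finset (Fin (2 * n))) → Finset (Fin (2 * n)) →
    Fin (2 * n) × Fin (2 * n)
  pivot_improving : ∀ X past U, IsBalanced U → ¬ IsLocalOpt X U →
    IsImprovingSwap X U (pivot X past U)

namespace Implementation

open Classical in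
/-- The earlier partitions (latest first) and the current partition after `t` rounds; nothing
changes any more once the current partition is locally optimal. -/
noncomputable def run {n : ℕ} (A : Implementation n) (X : Weights n) :
    ℕ → List (Finset (Fin (2 * n))) × Finset (Fin (2 * n))
  | 0 => ([], A.init X)
  | t + 1 =>
    let s := run A X t
    if IsLocalOpt X s.2 then s else (s.2 :: s.1, swapNodes s.2 (A.pivot X s.1 s.2))

/-- The number of steps (swaps) that the implementation makes on weights `X` until it terminates,
that is, until the current partition is locally optimal (`⊤` if this never happens). -/
noncomputable def steps {n : ℕ} (A : Implementation n) (X : Weights n) : ℕ∞ :=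
  ⨅ (t : ℕ) (_ : IsLocalOpt X (A.run X t).2), (t : ℕ∞)

end Implementation

/-- The largest number of steps that any implementation makes on weights `X`. -/
noncomputable def maxSteps {n : ℕ} (X : Weights n) : ℕ∞ :=
  ⨆ A : Implementation n, A.steps X

/-- `μ` is a probability distribution supported on `[-1, 1]` that has a density (with respect to
Lebesgue measure) bounded from above by `φ`. -/
def IsSmoothed (φ : ℝ) (μ : Measure ℝ) : Prop :=
  IsProbabilityMeasure μ ∧ μ (Set.Icc (-1) 1)ᶜ = 0 ∧
    ∃ f : ℝ → ℝ≥0∞, Measurable f ∧ (∀ x, f x ≤ ENNReal.ofReal φ) ∧ μ = volume.withDensity f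

/-- The quantity `φ * n ^ (C * (log n) ^ 10)`. -/
noncomputable def stepBound (C φ : ℝ) (n : ℕ) : ℝ := φ * (n : ℝ) ^ (C * Real.log n ^ 10)

end SwapPartition

/-!
A run of SWAP visits distinct balanced partitions, whose indicator vectors `x ∈ ℝ^(2n)` change by
`e_v - e_u` in each step. The cut is a quadratic function of `x`, so a relation `∑ κ_t (e_v - e_u) = 0`
between the steps of a run turns the corresponding combination of the gains into a linear form in
the weights that depends only on the sequence of swaps, not on the partition from which the run
starts (`IsSwapPath.sum_sqStep_eq`). The swap vectors form an oriented incidence matrix of a graph,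
so that the relations are generated by combinations along paths, with small integral coefficients
(`exists_relation_of_mem_span`). If the run gains at most `ε` in total, all these forms are of order
`n ε`; if `r` of them are linearly independent, this has probability at most `(O(n) φ ε) ^ r`,
because integral determinants are at least `1` (`measure_forms_le`).

For the union bound over the `(2n)^(2ℓ)` sequences of `ℓ` swaps, `r` has to be at least `ℓ` divided
by a polylogarithm. The number of independent forms is at least the excess of the dimension spanned
by the squares `x ⊗ x` over the dimension spanned by the vectors `x` of the run
(`IsSwapPath.exists_relations`). Two linearly independent families without proportional vectors have
few relations between their squares: contracting a relation `∑ a_i p_i ⊗ p_i = ∑ c_j q_j ⊗ q_j` with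
the dual functionals couples the coefficients in such a way that they come in groups of at least two
proportional ones (`exists_partner`), so that the relations have at most half the dimension of
`span p ∩ span q` (`two_mul_finrank_squareRelations_le`). Hence the excess of a window of a run is at
least half the dimension of the intersection of the spans of its two halves. If all dyadic windows had
a small excess, the dimensions of the dyadic windows would be almost additive, and `2 ^ k > 4 n`
points would span more than `2 n` dimensions (`exists_window`). Thus every run of `2 ^ k` points
contains a window of some length `ℓ` with excess more than `ℓ / (4 k)`, where `k = O(log n)`.

Altogether a run of `2 ^ k` points gains at most `ε` with probability at most `φ ε n^(O(log n))`
(`measure_stallSet_le`). As cuts are bounded by `2 n ^ 2`, this yields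
`P(maxSteps ≥ T) ≤ φ n^(O(log n)) / T`, and both claims follow; the expectation costs another factor
`O(n)` since no run is longer than `4 ^ n`.
-/

namespace SwapPartition

/-! ### Squares of vectors and the relations between them -/

/-- The symmetric square `x ⊗ x` of a vector, written as the table of its entries. -/
def sq {V : Type*} (x : V → ℝ) : V × V → ℝ := fun ab => x ab.1 * x ab.2

/-- Contraction of the first tensor factor with a linear functional. -/
noncomputable def contract {V : Type*} (f : (V → ℝ) →ₗ[ℝ] ℝ) :
    (V × V → ℝ) →ₗ[ℝ] (V → ℝ) where
  toFun M := fun b => f (fun a => M (a, b))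
  map_add' M N := by
    funext b
    exact f.map_add (fun a => M (a, b)) (fun a => N (a, b))
  map_smul' c M := by
    funext b
    exact f.map_smul c (fun a => M (a, b))

theorem contract_sq {V : Type*} (f : (V → ℝ) →ₗ[ℝ] ℝ) (x : V → ℝ) :
    contract f (sq x) = f x • x := by
  funext b
  change f (fun a => x a * x b) = f x * x b
  have : (fun a => x a * x b) = x b • x := by
    funext a; simp [mul_comm]
  rw [this, map_smul, smul_eq_mul, mul_comm]

/-- A linearly independent family has a dual family of functionals on the whole space. -/
theorem exists_dual_family {ι E : Type*} [DecidableEq ι] [AddCommGroup E] [Module ℝ E] {p : ι → E}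
    (hp : LinearIndependent ℝ p) :
    ∃ x : ι → E →ₗ[ℝ] ℝ, ∀ i k, x i (p k) = if k = i then 1 else 0 := by
  obtain ⟨g, hg⟩ := (Finsupp.linearCombination ℝ p).exists_leftInverse_of_injective
    (LinearMap.ker_eq_bot.2 hp)
  refine ⟨fun i => (Finsupp.lapply i).comp g, fun i k => ?_⟩
  have h := congrArg (fun F => F (Finsupp.single k (1 : ℝ))) hg
  simp only [LinearMap.comp_apply, Finsupp.linearCombination_single, one_smul,
    LinearMap.id_apply] at h
  simp [h, Finsupp.single_apply]

section SquareRelations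

variable {V ι κ : Type*} [Fintype ι] [Fintype κ]

/-- The linear relations `∑ i, z (inl i) • (p i ⊗ p i) = ∑ j, z (inr j) • (q j ⊗ q j)` between the
squares of two families. -/
noncomputable def squareRelations (p : ι → V → ℝ) (q : κ → V → ℝ) : Submodule ℝ (ι ⊕ κ → ℝ) :=
  LinearMap.ker (Fintype.linearCombination ℝ
    (Sum.elim (fun i => sq (p i)) (fun j => -sq (q j)) : ι ⊕ κ → V × V → ℝ))

theorem mem_squareRelations {p : ι → V → ℝ} {q : κ → V → ℝ} {z : ι ⊕ κ → ℝ} :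
    z ∈ squareRelations p q ↔
      ∑ i, z (Sum.inl i) • sq (p i) = ∑ j, z (Sum.inr j) • sq (q j) := by
  rw [squareRelations, LinearMap.mem_ker, Fintype.linearCombination_apply]
  simp only [Fintype.sum_sum_type, Sum.elim_inl, Sum.elim_inr, smul_neg, Finset.sum_neg_distrib]
  rw [← sub_eq_add_neg, sub_eq_zero]

theorem sum_contract_eq {p : ι → V → ℝ} {q : κ → V → ℝ} {z : ι ⊕ κ → ℝ}
    (hz : z ∈ squareRelations p q) (f : (V → ℝ) →ₗ[ℝ] ℝ) :
    ∑ i, (z (Sum.inl i) * f (p i)) • p i = ∑ j, (z (Sum.inr j) * f (q j)) • q j := by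
  have h := congrArg (contract f) (mem_squareRelations.1 hz)
  simpa only [map_sum, map_smul, contract_sq, smul_smul] using h

/-- A vector of the first family that occurs in a relation between squares lies in the span of
the second family. -/
theorem smul_eq_sum_of_mem_squareRelations [DecidableEq ι] {p : ι → V → ℝ} {q : κ → V → ℝ} {z : ι ⊕ κ → ℝ}
    (hz : z ∈ squareRelations p q) {x : ι → (V → ℝ) →ₗ[ℝ] ℝ}
    (hx : ∀ i k, x i (p k) = if k = i then 1 else 0) (i : ι) :
    z (Sum.inl i) • p i = ∑ j, (z (Sum.inr j) * x i (q j)) • q j := by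
  rw [← sum_contract_eq hz (x i)]
  simp [hx]

theorem squareRelations_symm {p : ι → V → ℝ} {q : κ → V → ℝ} {z : ι ⊕ κ → ℝ}
    (hz : z ∈ squareRelations p q) : z ∘ Sum.swap ∈ squareRelations q p := by
  rw [mem_squareRelations] at hz ⊢
  simpa using hz.symm

theorem smul_eq_sum_of_mem_squareRelations' [DecidableEq κ] {p : ι → V → ℝ} {q : κ → V → ℝ} {z : ι ⊕ κ → ℝ}
    (hz : z ∈ squareRelations p q) {y : κ → (V → ℝ) →ₗ[ℝ] ℝ}
    (hy : ∀ j k, y j (q k) = if k = j then 1 else 0) (j : κ) :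
    z (Sum.inr j) • q j = ∑ i, (z (Sum.inl i) * y j (p i)) • p i := by
  simpa using smul_eq_sum_of_mem_squareRelations (squareRelations_symm hz) hy j

/-- Contracting both tensor factors couples the coefficients of the two families: this is the
relation that forces coefficients to be proportional. -/
theorem coupling [DecidableEq ι] [DecidableEq κ] {p : ι → V → ℝ} {q : κ → V → ℝ} {z : ι ⊕ κ → ℝ}
    (hz : z ∈ squareRelations p q) {x : ι → (V → ℝ) →ₗ[ℝ] ℝ} {y : κ → (V → ℝ) →ₗ[ℝ] ℝ}
    (hx : ∀ i k, x i (p k) = if k = i then 1 else 0)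
    (hy : ∀ j k, y j (q k) = if k = j then 1 else 0) (i : ι) (j : κ) :
    z (Sum.inl i) * y j (p i) = z (Sum.inr j) * x i (q j) := by
  have h := congrArg (y j) (smul_eq_sum_of_mem_squareRelations hz hx i)
  simpa [hy] using h

/-- If no vector of the second family is a multiple of one of the first, then each coefficient
that does not vanish on all relations is a fixed multiple of another one. -/
theorem exists_partner {p : ι → V → ℝ} {q : κ → V → ℝ} (hp : LinearIndependent ℝ p)
    (hq : LinearIndependent ℝ q) (hpq : ∀ i j (c : ℝ), q j ≠ c • p i) {i : ι} {z : ι ⊕ κ → ℝ}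
    (hz : z ∈ squareRelations p q) (hzi : z (Sum.inl i) ≠ 0) :
    ∃ k, k ≠ i ∧ z (Sum.inl k) ≠ 0 ∧
      ∃ s : ℝ, ∀ z' ∈ squareRelations p q, z' (Sum.inl k) = s * z' (Sum.inl i) := by
  classical
  obtain ⟨x, hx⟩ := exists_dual_family hp
  obtain ⟨y, hy⟩ := exists_dual_family hq
  have h1 := smul_eq_sum_of_mem_squareRelations hz hx i
  obtain ⟨j, hj⟩ : ∃ j, z (Sum.inr j) * x i (q j) ≠ 0 := by
    by_contra! hcon
    simp only [hcon, zero_smul, Finset.sum_const_zero] at h1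
    exact (smul_ne_zero hzi (hp.ne_zero i)) h1
  have h2 := smul_eq_sum_of_mem_squareRelations' hz hy j
  have hcj : z (Sum.inr j) ≠ 0 := left_ne_zero_of_mul hj
  obtain ⟨k, hki, hk⟩ : ∃ k, k ≠ i ∧ z (Sum.inl k) * y j (p k) ≠ 0 := by
    by_contra! hcon
    rw [Finset.sum_eq_single i (fun k _ hk => by rw [hcon k hk, zero_smul]) (by simp)] at h2
    refine hpq i j ((z (Sum.inr j))⁻¹ * (z (Sum.inl i) * y j (p i))) ?_
    rw [mul_smul, ← h2, inv_smul_smul₀ hcj]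
  have hxi : x i (q j) ≠ 0 := right_ne_zero_of_mul hj
  have hyk : y j (p k) ≠ 0 := right_ne_zero_of_mul hk
  refine ⟨k, hki, left_ne_zero_of_mul hk, x k (q j) * y j (p i) / (y j (p k) * x i (q j)),
    fun z' hz' => ?_⟩
  have e1 := coupling hz' hx hy i j
  have e2 := coupling hz' hx hy k j
  field_simp
  linear_combination x i (q j) * e2 - x k (q j) * e1

/-- Two linearly independent families without proportional vectors satisfy few relations between
squares: at most half the dimension of the intersection of their spans. -/
theorem two_mul_finrank_squareRelations_le [Finite V] {p : ι → V → ℝ} {q : κ → V → ℝ}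
    (hp : LinearIndependent ℝ p) (hq : LinearIndependent ℝ q)
    (hpq : ∀ i j (c : ℝ), q j ≠ c • p i) :
    2 * Module.finrank ℝ (squareRelations p q) ≤
      Module.finrank ℝ
        (Submodule.span ℝ (Set.range p) ⊓ Submodule.span ℝ (Set.range q) : Submodule ℝ (V → ℝ)) := by
  classical
  set R := squareRelations p q with hR
  let ε : ι → R →ₗ[ℝ] ℝ := fun i => (LinearMap.proj (Sum.inl i)).comp R.subtype
  have hε : ∀ i (z : R), ε i z = z.1 (Sum.inl i) := fun i z => rfl
  obtain ⟨y, hy⟩ := exists_dual_family hq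
  obtain ⟨x, hx⟩ := exists_dual_family hp
  have hinj : ∀ z : R, (∀ i, ε i z = 0) → z = 0 := by
    intro z hz
    ext s
    rcases s with i | j
    · exact hz i
    · have := smul_eq_sum_of_mem_squareRelations' z.2 hy j
      simp only [← hε, hz, zero_mul, zero_smul, Finset.sum_const_zero] at this
      exact (smul_eq_zero.1 this).resolve_right (hq.ne_zero j)
  obtain ⟨B, b, hb, hspan, hli⟩ := exists_linearIndependent' ℝ ε
  have : Fintype B := Fintype.ofInjective b hb
  -- The chosen coordinate functionals separate the relations.
  have hcard : Module.finrank ℝ R ≤ Fintype.card B := by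
    rw [← Module.finrank_fintype_fun_eq_card ℝ (η := B)]
    refine LinearMap.finrank_le_finrank_of_injective
      (f := LinearMap.pi fun k => ε (b k)) ((injective_iff_map_eq_zero _).2 fun z hz => ?_)
    refine hinj z fun i => ?_
    have hi : ε i ∈ Submodule.span ℝ (Set.range (ε ∘ b)) :=
      hspan ▸ Submodule.subset_span ⟨i, rfl⟩
    have hle : Submodule.span ℝ (Set.range (ε ∘ b)) ≤
        LinearMap.ker (LinearMap.applyₗ z : (R →ₗ[ℝ] ℝ) →ₗ[ℝ] ℝ) := by
      rw [Submodule.span_le]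
      rintro _ ⟨k, rfl⟩
      exact congrFun hz k
    exact hle hi
  have hpartner : ∀ k : B, ∃ l, l ≠ b k ∧ ε l ≠ 0 ∧ ∃ s : ℝ, ε l = s • ε (b k) := by
    intro k
    obtain ⟨z, hz⟩ : ∃ z, ε (b k) z ≠ 0 := by
      by_contra! hcon
      exact hli.ne_zero k (LinearMap.ext hcon)
    obtain ⟨l, hl, hzl, s, hs⟩ := exists_partner hp hq hpq z.2 hz
    exact ⟨l, hl, fun h => hzl (by rw [← hε, h]; rfl), s, LinearMap.ext fun z' => hs z'.1 z'.2⟩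
  choose f hfne hf0 s hs using hpartner
  have hs0 : ∀ k, s k ≠ 0 := fun k h => hf0 k (by rw [hs k, h, zero_smul])
  have hprop : ∀ k l : B, (∃ c : ℝ, ε (b k) = c • ε (b l)) → k = l := by
    rintro k l ⟨c, hc⟩
    have h : Finsupp.linearCombination ℝ (ε ∘ b) (Finsupp.single k 1) =
        Finsupp.linearCombination ℝ (ε ∘ b) (Finsupp.single l c) := by
      simpa using hc
    have h' := DFunLike.congr_fun (hli h) k
    by_contra hkl
    rw [Finsupp.single_eq_same, Finsupp.single_eq_of_ne hkl] at h'
    exact one_ne_zero h'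
  have hfinj : Function.Injective (Sum.elim b f : B ⊕ B → ι) := by
    refine Function.Injective.sumElim hb ?_ ?_
    · intro k l hkl
      refine hprop k l ⟨(s k)⁻¹ * s l, ?_⟩
      rw [mul_smul, ← hs l, ← hkl, hs k, inv_smul_smul₀ (hs0 k)]
    · intro k l hkl
      have : k = l := hprop k l ⟨s l, by rw [← hs l, ← hkl]⟩
      subst this
      exact hfne k hkl.symm
  have hmem : ∀ i, ε i ≠ 0 → p i ∈
      (Submodule.span ℝ (Set.range p) ⊓ Submodule.span ℝ (Set.range q) : Submodule ℝ (V → ℝ)) := by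
    intro i hi
    refine ⟨Submodule.subset_span ⟨i, rfl⟩, ?_⟩
    obtain ⟨z, hz⟩ : ∃ z, ε i z ≠ 0 := by
      by_contra! hcon
      exact hi (LinearMap.ext hcon)
    have h1 := smul_eq_sum_of_mem_squareRelations z.2 hx i
    refine (Submodule.smul_mem_iff _ (show z.1 (Sum.inl i) ≠ 0 from hz)).1 ?_
    rw [h1]
    exact Submodule.sum_mem _ fun j _ => Submodule.smul_mem _ _ (Submodule.subset_span ⟨j, rfl⟩)
  have hmem' : ∀ k, p (Sum.elim b f k) ∈
      (Submodule.span ℝ (Set.range p) ⊓ Submodule.span ℝ (Set.range q) : Submodule ℝ (V → ℝ)) := by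
    rintro (k | k)
    · exact hmem _ (hli.ne_zero k)
    · exact hmem _ (hf0 k)
  have hle : Submodule.span ℝ (Set.range (p ∘ Sum.elim b f)) ≤
      (Submodule.span ℝ (Set.range p) ⊓ Submodule.span ℝ (Set.range q) : Submodule ℝ (V → ℝ)) := by
    rw [Submodule.span_le]
    rintro _ ⟨k, rfl⟩
    exact hmem' k
  have := Submodule.finrank_mono hle
  rw [finrank_span_eq_card (hp.comp _ hfinj), Fintype.card_sum] at this
  omega

end SquareRelations

/-! ### The number of linearly independent quadratic conditions on a set of vectors -/

section Hilbert

variable {V : Type*}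

/-- The dimension of the span of a set of vectors. -/
noncomputable def linDim (S : Set (V → ℝ)) : ℕ := Module.finrank ℝ (Submodule.span ℝ S)

/-- The dimension of the span of the squares of a set of vectors. -/
noncomputable def sqDim (S : Set (V → ℝ)) : ℕ := Module.finrank ℝ (Submodule.span ℝ (sq '' S))

/-- A set of vectors has squares spanning much more than the vectors themselves as soon as it is
the union of two parts whose spans overlap. -/
theorem linDim_add_le [Finite V] {S₁ S₂ : Set (V → ℝ)} (h : ∀ x ∈ S₁, ∀ y ∈ S₂, ∀ c : ℝ, y ≠ c • x) :
    linDim S₁ + linDim S₂ + linDim (S₁ ∪ S₂) ≤ 2 * sqDim (S₁ ∪ S₂) := by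
  classical
  obtain ⟨b₁, hb₁, hs₁, hl₁⟩ := exists_linearIndependent ℝ S₁
  obtain ⟨b₂, hb₂, hs₂, hl₂⟩ := exists_linearIndependent ℝ S₂
  have : Fintype b₁ := hl₁.setFinite.fintype
  have : Fintype b₂ := hl₂.setFinite.fintype
  have key := two_mul_finrank_squareRelations_le hl₁ hl₂
    (fun i j c => h _ (hb₁ i.2) _ (hb₂ j.2) c)
  have hr : ∀ b : Set (V → ℝ), Set.range (fun i : b => i.1) = b := fun b => Subtype.range_coe
  rw [hr, hr, hs₁, hs₂] at key
  have hdim := Submodule.finrank_sup_add_finrank_inf_eq (Submodule.span ℝ S₁) (Submodule.span ℝ S₂)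
  rw [← Submodule.span_union] at hdim
  have hc₁ : linDim S₁ = Fintype.card b₁ := by
    rw [linDim, ← hs₁, ← finrank_span_eq_card hl₁, Subtype.range_coe]
  have hc₂ : linDim S₂ = Fintype.card b₂ := by
    rw [linDim, ← hs₂, ← finrank_span_eq_card hl₂, Subtype.range_coe]
  let F := Fintype.linearCombination ℝ (Sum.elim (fun i => sq i.1) (fun j => -sq j.1) :
    b₁ ⊕ b₂ → V × V → ℝ)
  have hrn := LinearMap.finrank_range_add_finrank_ker F
  rw [Module.finrank_fintype_fun_eq_card, Fintype.card_sum] at hrn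
  have hrange : Module.finrank ℝ (LinearMap.range F) ≤ sqDim (S₁ ∪ S₂) := by
    refine Submodule.finrank_mono ?_
    rw [Fintype.range_linearCombination, Submodule.span_le]
    rintro _ ⟨i | j, rfl⟩
    · exact Submodule.subset_span ⟨_, Or.inl (hb₁ i.2), rfl⟩
    · exact Submodule.neg_mem _ (Submodule.subset_span ⟨_, Or.inr (hb₂ j.2), rfl⟩)
  have hker : Module.finrank ℝ (LinearMap.ker F) =
    Module.finrank ℝ (squareRelations (Subtype.val : b₁ → V → ℝ) (Subtype.val : b₂ → V → ℝ)) := rfl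
  simp only [linDim] at *
  omega

/-- In a sequence of `2 ^ k` pairwise non-proportional vectors in a space of dimension less than
`2 ^ (k - 1)`, some window has squares that span substantially more than its vectors. Otherwise
the dimensions of the dyadic windows would add up almost without loss from each level to the
next. -/
theorem exists_window [Fintype V] {P : ℕ → V → ℝ} {k : ℕ} (hk : 0 < k)
    (hP : ∀ s t, s < 2 ^ k → t < 2 ^ k → s ≠ t → ∀ c : ℝ, P t ≠ c • P s)
    (hP0 : ∀ s < 2 ^ k, P s ≠ 0) (hV : 2 * Fintype.card V < 2 ^ k) :
    ∃ i < k, ∃ a, a + 2 ^ (i + 1) ≤ 2 ^ k ∧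
      2 ^ (i + 1) + 4 * k * linDim (P '' Set.Ico a (a + 2 ^ (i + 1))) <
        4 * k * sqDim (P '' Set.Ico a (a + 2 ^ (i + 1))) := by
  by_contra! hcon
  have main : ∀ i ≤ k, ∀ a, a + 2 ^ i ≤ 2 ^ k →
      2 * k * 2 ^ i ≤ i * 2 ^ i + 2 * k * linDim (P '' Set.Ico a (a + 2 ^ i)) := by
    intro i
    induction i with
    | zero =>
      intro _ a ha
      have h1 : linDim (P '' Set.Ico a (a + 2 ^ 0)) = 1 := by
        rw [pow_zero, show Set.Ico a (a + 1) = {a} by ext; simp; omega, Set.image_singleton, linDim]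
        exact finrank_span_singleton (hP0 a (by omega))
      rw [h1]; omega
    | succ i ih =>
      intro hi a ha
      have h2 : 2 ^ (i + 1) = 2 ^ i + 2 ^ i := by ring
      have h0 : 0 < 2 ^ i := by positivity
      have e1 := ih (by omega) a (by omega)
      have e2 := ih (by omega) (a + 2 ^ i) (by omega)
      have hun : P '' Set.Ico a (a + 2 ^ i) ∪ P '' Set.Ico (a + 2 ^ i) (a + 2 ^ i + 2 ^ i) =
          P '' Set.Ico a (a + 2 ^ (i + 1)) := by
        rw [← Set.image_union, Set.Ico_union_Ico_eq_Ico (by omega) (by omega), h2, add_assoc]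
      have e3 := linDim_add_le (S₁ := P '' Set.Ico a (a + 2 ^ i))
        (S₂ := P '' Set.Ico (a + 2 ^ i) (a + 2 ^ i + 2 ^ i)) (by
          rintro _ ⟨s, hs, rfl⟩ _ ⟨t, ht, rfl⟩
          rw [Set.mem_Ico] at hs ht
          exact hP s t (by omega) (by omega) (by omega))
      rw [hun] at e3
      have e4 := hcon i (by omega) a ha
      have e5 := Nat.mul_le_mul_left (2 * k) e3
      rw [h2] at *
      nlinarith
  have h1 := main k le_rfl 0 (by simp)
  have h2 : linDim (P '' Set.Ico 0 (0 + 2 ^ k)) ≤ Fintype.card V := by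
    have := Submodule.finrank_le (Submodule.span ℝ (P '' Set.Ico 0 (0 + 2 ^ k)))
    rwa [Module.finrank_fintype_fun_eq_card] at this
  have h3 := Nat.mul_le_mul_left (2 * k) h2
  have h4 : k * (2 * Fintype.card V) < k * 2 ^ k := Nat.mul_lt_mul_of_pos_left hV hk
  nlinarith

end Hilbert

/-! ### Small integral relations between swap vectors -/

section SwapVectors

variable {V T : Type*} [DecidableEq V]

/-- The change of the indicator vector of a part when `p.1` leaves it and `p.2` enters it. -/
def swapVec (p : V × V) : V → ℝ := Pi.single p.2 1 - Pi.single p.1 1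

theorem swapVec_swap (a b : V) : swapVec (b, a) = -swapVec (a, b) := by
  simp [swapVec]

theorem swapVec_add (a b c : V) : swapVec (a, b) + swapVec (b, c) = swapVec (a, c) := by
  simp only [swapVec]; abel

/-- The graph whose edges are the pairs swapped in the steps belonging to `S`. -/
def swapGraph (w : T → V × V) (S : Set T) : SimpleGraph V :=
  SimpleGraph.fromRel fun a b => ∃ t ∈ S, w t = (a, b)

theorem exists_relation_of_walk [Fintype T] [DecidableEq T] (w : T → V × V) (S : Set T) {a b : V}
    (W : (swapGraph w S).Walk a b) :
    ∃ κ : T → ℤ, (∀ t ∉ S, κ t = 0) ∧ ∑ t, |κ t| ≤ W.length ∧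
      swapVec (a, b) = ∑ t, (κ t : ℝ) • swapVec (w t) := by
  induction W with
  | nil => exact ⟨0, by simp, by simp, by simp [swapVec]⟩
  | @cons a c b h W ih =>
    obtain ⟨κ, hS, hκ, hsum⟩ := ih
    obtain ⟨t, ht, z, hz, htz⟩ : ∃ t ∈ S, ∃ z : ℤ, |z| = 1 ∧
        swapVec (a, c) = (z : ℝ) • swapVec (w t) := by
      rcases ((SimpleGraph.fromRel_adj _ _ _).1 h).2 with ⟨t, ht, hw⟩ | ⟨t, ht, hw⟩
      · exact ⟨t, ht, 1, by simp, by simp [hw]⟩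
      · exact ⟨t, ht, -1, by simp, by simp [hw, swapVec_swap a c]⟩
    refine ⟨fun s => κ s + if s = t then z else 0, fun s hs => ?_, ?_, ?_⟩
    · have : s ≠ t := fun h => hs (h ▸ ht)
      simp [hS s hs, this]
    · calc ∑ s, |κ s + if s = t then z else 0| ≤ ∑ s, (|κ s| + if s = t then 1 else 0) := by
            refine Finset.sum_le_sum fun s _ => (abs_add_le _ _).trans ?_
            split_ifs <;> simp [hz]
        _ = ∑ s, |κ s| + 1 := by simp [Finset.sum_add_distrib]
        _ ≤ _ := by
            rw [SimpleGraph.Walk.length_cons]; push_cast; linarith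
    · rw [← swapVec_add a c b, hsum, htz]
      simp [add_smul, Finset.sum_add_distrib, ite_smul, add_comm]

/-- The swap vectors form an oriented incidence matrix of a graph: a swap vector in the span of
others is a combination of them with coefficients from a path, so that these are small integers. -/
theorem exists_relation_of_mem_span [Fintype V] [Fintype T] [DecidableEq T] (w : T → V × V)
    (S : Set T) (p : V × V)
    (h : swapVec p ∈ Submodule.span ℝ ((fun t => swapVec (w t)) '' S)) :
    ∃ κ : T → ℤ, (∀ t ∉ S, κ t = 0) ∧ ∑ t, |κ t| ≤ Fintype.card V ∧
      swapVec p = ∑ t, (κ t : ℝ) • swapVec (w t) := by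
  classical
  have hreach : (swapGraph w S).Reachable p.1 p.2 := by
    by_contra hcon
    -- Summing the coordinates over a component annihilates the swaps inside the components.
    let f : (V → ℝ) →ₗ[ℝ] ℝ := Fintype.linearCombination ℝ
      fun v => if (swapGraph w S).Reachable p.1 v then (1 : ℝ) else 0
    have hf : ∀ a b, f (swapVec (a, b)) =
        (if (swapGraph w S).Reachable p.1 b then (1 : ℝ) else 0) -
          (if (swapGraph w S).Reachable p.1 a then (1 : ℝ) else 0) := by
      intro a b
      rw [swapVec, map_sub, Fintype.linearCombination_apply_single,
        Fintype.linearCombination_apply_single, one_smul, one_smul]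
    have hle : Submodule.span ℝ ((fun t => swapVec (w t)) '' S) ≤ LinearMap.ker f := by
      rw [Submodule.span_le]
      rintro _ ⟨t, ht, rfl⟩
      change f (swapVec ((w t).1, (w t).2)) = 0
      rw [hf]
      by_cases he : (w t).1 = (w t).2
      · simp [he]
      have hadj : (swapGraph w S).Adj (w t).1 (w t).2 :=
        (SimpleGraph.fromRel_adj _ _ _).2 ⟨he, Or.inl ⟨t, ht, rfl⟩⟩
      have : (swapGraph w S).Reachable p.1 (w t).2 ↔ (swapGraph w S).Reachable p.1 (w t).1 :=
        ⟨fun h => h.trans hadj.symm.reachable, fun h => h.trans hadj.reachable⟩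
      simp [this]
    have h0 : f (swapVec (p.1, p.2)) = 0 := hle h
    rw [hf] at h0
    simp [hcon] at h0
  obtain ⟨W⟩ := hreach
  obtain ⟨κ, h1, h2, h3⟩ := exists_relation_of_walk w S W.toPath.1
  refine ⟨κ, h1, h2.trans ?_, h3⟩
  exact_mod_cast W.toPath.2.length_lt.le

end SwapVectors

/-- A family whose span has dimension at least `r` contains `r` linearly independent members. -/
theorem exists_linearIndependent_fin {ι E : Type*} [Finite ι] [AddCommGroup E] [Module ℝ E]
    (v : ι → E) {r : ℕ} (hr : r ≤ Module.finrank ℝ (Submodule.span ℝ (Set.range v))) :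
    ∃ f : Fin r → ι, LinearIndependent ℝ (v ∘ f) := by
  obtain ⟨B, b, hb, hspan, hli⟩ := exists_linearIndependent' ℝ v
  have : Finite B := Finite.of_injective b hb
  have : Fintype B := Fintype.ofFinite B
  rw [← hspan, finrank_span_eq_card hli] at hr
  let g : Fin r → B := fun i => (Fintype.equivFin B).symm (Fin.castLE hr i)
  have hg : Function.Injective g :=
    (Fintype.equivFin B).symm.injective.comp (Fin.castLE_injective hr)
  exact ⟨b ∘ g, hli.comp g hg⟩

/-! ### The linear forms attached to a sequence of swaps -/

section Forms

variable {n m : ℕ}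

/-- The indicator vector of the first part of a partition. -/
def ind (U : Finset (Fin (2 * n))) : Fin (2 * n) → ℝ := fun v => if v ∈ U then 1 else 0

open Classical in
/-- The indicator function of the edges of a cut. -/
noncomputable def crossing (U : Finset (Fin (2 * n))) (e : Edge n) : ℤ :=
  if Crosses U e then 1 else 0

theorem cut_eq_sum (X : Weights n) (U : Finset (Fin (2 * n))) :
    cut X U = ∑ e, (crossing U e : ℝ) * X e := by
  refine Finset.sum_congr rfl fun e _ => ?_
  unfold crossing
  split_ifs <;> simp

theorem crossing_eq (U : Finset (Fin (2 * n))) (e : Edge n) {a b : Fin (2 * n)}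
    (he : e.1 = s(a, b)) :
    (crossing U e : ℝ) = ind U a + ind U b - 2 * (ind U a * ind U b) := by
  have hc : Crosses U e ↔ (a ∈ U ∧ b ∉ U) ∨ (b ∈ U ∧ a ∉ U) := by
    constructor
    · rintro ⟨u, v, h, hu, hv⟩
      rw [he, Sym2.eq_iff] at h
      rcases h with ⟨rfl, rfl⟩ | ⟨rfl, rfl⟩
      · exact Or.inl ⟨hu, hv⟩
      · exact Or.inr ⟨hu, hv⟩
    · rintro (⟨hu, hv⟩ | ⟨hu, hv⟩)
      · exact ⟨a, b, he, hu, hv⟩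
      · exact ⟨b, a, he.trans Sym2.eq_swap, hu, hv⟩
  unfold crossing ind
  by_cases ha : a ∈ U <;> by_cases hb : b ∈ U <;> (simp [hc, ha, hb]; try norm_num)

theorem sum_ind (U : Finset (Fin (2 * n))) : ∑ v, ind U v = U.card := by
  simp [ind]

theorem ind_mul_self (U : Finset (Fin (2 * n))) (v : Fin (2 * n)) : ind U v * ind U v = ind U v := by
  unfold ind; split_ifs <;> simp

theorem ind_ne_zero {U : Finset (Fin (2 * n))} (hn : 1 ≤ n) (hU : IsBalanced U) : ind U ≠ 0 := by
  intro h
  have := sum_ind U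
  rw [h, hU] at this
  simp only [Pi.zero_apply, Finset.sum_const_zero] at this
  have hn' : (n : ℝ) ≠ 0 := by positivity
  exact hn' this.symm

theorem ind_ne_smul {U U' : Finset (Fin (2 * n))} (hn : 1 ≤ n) (hU : IsBalanced U)
    (hU' : IsBalanced U') (h : U ≠ U') (c : ℝ) : ind U' ≠ c • ind U := by
  intro hc
  have h1 : ∑ v, ind U' v = c * ∑ v, ind U v := by
    rw [hc, Finset.mul_sum]; rfl
  rw [sum_ind, sum_ind, hU, hU'] at h1
  have hn' : (n : ℝ) ≠ 0 := by positivity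
  have hc1 : c = 1 := by
    field_simp at h1
    linarith
  rw [hc1, one_smul] at hc
  apply h
  ext v
  have := congrFun hc v
  unfold ind at this
  by_cases hv : v ∈ U <;> by_cases hv' : v ∈ U' <;> simp_all

/-- The partitions `U 0, …, U m` are obtained from each other by the swaps `w 0, …, w (m - 1)`. -/
def IsSwapPath (w : Fin m → Fin (2 * n) × Fin (2 * n)) (U : ℕ → Finset (Fin (2 * n))) : Prop :=
  ∀ t : Fin m, (w t).1 ∈ U t ∧ (w t).2 ∉ U t ∧ U (t + 1) = swapNodes (U t) (w t)

theorem ind_swapNodes {U : Finset (Fin (2 * n))} {p : Fin (2 * n) × Fin (2 * n)} (h1 : p.1 ∈ U)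
    (h2 : p.2 ∉ U) : ind (swapNodes U p) = ind U + swapVec p := by
  funext v
  have hne : p.1 ≠ p.2 := fun h => h2 (h ▸ h1)
  simp only [ind, swapNodes, swapVec, Pi.add_apply, Pi.sub_apply, Pi.single_apply,
    Finset.mem_insert, Finset.mem_erase]
  by_cases hv1 : v = p.1
  · subst hv1; simp [h1, hne]
  · by_cases hv2 : v = p.2
    · subst hv2; simp [h2, hne.symm]
    · simp [hv1, hv2]

variable {w : Fin m → Fin (2 * n) × Fin (2 * n)} {U U' : ℕ → Finset (Fin (2 * n))}

theorem IsSwapPath.ind_succ (h : IsSwapPath w U) (t : Fin m) :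
    ind (U (t + 1)) = ind (U t) + swapVec (w t) := by
  rw [(h t).2.2, ind_swapNodes (h t).1 (h t).2.1]

/-- The change of the squared indicator vector in a step. -/
noncomputable def sqStep (U : ℕ → Finset (Fin (2 * n))) (t : Fin m) :
    Fin (2 * n) × Fin (2 * n) → ℝ :=
  sq (ind (U (t + 1))) - sq (ind (U t))

/-- Two runs that perform the same swaps differ by a constant vector. -/
theorem IsSwapPath.ind_sub_eq (h : IsSwapPath w U) (h' : IsSwapPath w U') :
    ∀ t ≤ m, ind (U' t) - ind (U t) = ind (U' 0) - ind (U 0) := by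
  intro t
  induction t with
  | zero => simp
  | succ t ih =>
    intro ht
    have e1 := h.ind_succ ⟨t, ht⟩
    have e2 := h'.ind_succ ⟨t, ht⟩
    simp only at e1 e2
    rw [← ih (by omega), e1, e2]
    abel

/-- For a relation between swap vectors, the corresponding combination of squared steps depends
only on the swaps and not on the partition from which the run starts. -/
theorem IsSwapPath.sum_sqStep_eq (h : IsSwapPath w U) (h' : IsSwapPath w U') {κ : Fin m → ℝ}
    (hκ : ∑ t, κ t • swapVec (w t) = 0) :
    ∑ t, κ t • sqStep U' t = ∑ t, κ t • sqStep U t := by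
  have hκ' : ∀ v, ∑ t, κ t * swapVec (w t) v = 0 := fun v => by
    simpa using congrFun hκ v
  rw [← sub_eq_zero, ← Finset.sum_sub_distrib]
  funext ⟨a, b⟩
  set δ := ind (U' 0) - ind (U 0) with hδ
  have hterm : ∀ t : Fin m, (κ t • sqStep U' t - κ t • sqStep U t) (a, b) =
      δ a * (κ t * swapVec (w t) b) + δ b * (κ t * swapVec (w t) a) := by
    intro t
    have e1 := h.ind_succ t
    have e2 := h'.ind_succ t
    have e3 : ind (U' t) = ind (U t) + δ := by
      rw [hδ, ← h.ind_sub_eq h' t t.2.le]; abel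
    simp only [sqStep, sq, Pi.sub_apply, Pi.smul_apply, smul_eq_mul, e1, e2, e3, Pi.add_apply]
    ring
  rw [Finset.sum_apply, Finset.sum_congr rfl fun t _ => hterm t, Finset.sum_add_distrib,
    ← Finset.mul_sum, ← Finset.mul_sum, hκ', hκ']
  simp

/-- For a relation between swap vectors, the corresponding combination of changes of the cut is
a linear form in the weights whose coefficients are entries of a combination of squared steps. -/
theorem IsSwapPath.sum_crossing_eq (h : IsSwapPath w U) {κ : Fin m → ℝ}
    (hκ : ∑ t, κ t • swapVec (w t) = 0) {e : Edge n} {a b : Fin (2 * n)} (he : e.1 = s(a, b)) :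
    ∑ t, κ t * ((crossing (U (t + 1)) e : ℝ) - crossing (U t) e) =
      -2 * (∑ t, κ t • sqStep U t) (a, b) := by
  have hκ' : ∀ v, ∑ t, κ t * swapVec (w t) v = 0 := fun v => by
    simpa using congrFun hκ v
  have hterm : ∀ t : Fin m, κ t * ((crossing (U (t + 1)) e : ℝ) - crossing (U t) e) =
      κ t * swapVec (w t) a + κ t * swapVec (w t) b + -2 * (κ t • sqStep U t) (a, b) := by
    intro t
    rw [crossing_eq _ e he, crossing_eq _ e he]
    simp only [sqStep, sq, Pi.sub_apply, Pi.smul_apply, smul_eq_mul, h.ind_succ t, Pi.add_apply]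
    ring
  rw [Finset.sum_congr rfl fun t _ => hterm t, Finset.sum_add_distrib, Finset.sum_add_distrib,
    hκ', hκ', Finset.sum_apply, Finset.mul_sum]
  simp

/-- The diagonal of a square of an indicator vector is the vector itself. -/
theorem IsSwapPath.sum_sqStep_diag (h : IsSwapPath w U) {κ : Fin m → ℝ}
    (hκ : ∑ t, κ t • swapVec (w t) = 0) (a : Fin (2 * n)) :
    (∑ t, κ t • sqStep U t) (a, a) = 0 := by
  have hκ' : ∑ t, κ t * swapVec (w t) a = 0 := by
    simpa using congrFun hκ a
  rw [← hκ', Finset.sum_apply]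
  refine Finset.sum_congr rfl fun t _ => ?_
  simp only [sqStep, sq, Pi.sub_apply, Pi.smul_apply, smul_eq_mul, ind_mul_self, h.ind_succ t,
    Pi.add_apply]
  have := ind_mul_self (U (t + 1)) a
  rw [h.ind_succ t, Pi.add_apply] at this
  rw [this]
  ring

/-- The span of the squares of a run is larger than the span of its vectors by at most the
dimension contributed by the relations between swap vectors with small integral coefficients. -/
theorem IsSwapPath.exists_relations (hn : 1 ≤ n) (h : IsSwapPath w U) (h0 : IsBalanced (U 0)) :
    ∃ κ : Fin m → Fin m → ℤ, (∀ t, ∑ s, |κ t s| ≤ 2 * n + 1) ∧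
      (∀ t, ∑ s, (κ t s : ℝ) • swapVec (w s) = 0) ∧
      sqDim ((fun t => ind (U t)) '' Set.Ico 0 (0 + (m + 1))) ≤
        linDim ((fun t => ind (U t)) '' Set.Ico 0 (0 + (m + 1))) +
        Module.finrank ℝ (Submodule.span ℝ
          (Set.range fun t => ∑ s, (κ t s : ℝ) • (sqStep U s : _ → ℝ))) := by
  classical
  set W := (fun t => ind (U t)) '' Set.Ico 0 (0 + (m + 1)) with hW
  have hmemW : ∀ t ≤ m, ind (U t) ∈ W := fun t ht => ⟨t, by simp; omega, rfl⟩
  obtain ⟨B, b, hb, hspan, hli⟩ := exists_linearIndependent' ℝ (fun t => swapVec (w t))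
  have hfin : Finite B := Finite.of_injective b hb
  have : Fintype B := Fintype.ofFinite B
  set S := Set.range b with hS
  have himg : (fun t => swapVec (w t)) '' S = Set.range ((fun t => swapVec (w t)) ∘ b) := by
    rw [Set.range_comp]
  have hmem : ∀ t, swapVec (w t) ∈ Submodule.span ℝ ((fun t => swapVec (w t)) '' S) := fun t => by
    rw [himg, hspan]; exact Submodule.subset_span ⟨t, rfl⟩
  choose κ hκS hκ1 hκ using fun t => exists_relation_of_mem_span w S (w t) (hmem t)
  refine ⟨fun t => Pi.single t 1 - κ t, fun t => ?_, fun t => ?_, ?_⟩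
  · calc ∑ s, |(Pi.single t 1 - κ t : Fin m → ℤ) s|
        ≤ ∑ s, (|(Pi.single t 1 : Fin m → ℤ) s| + |κ t s|) :=
          Finset.sum_le_sum fun s _ => abs_sub _ _
      _ = 1 + ∑ s, |κ t s| := by
          rw [Finset.sum_add_distrib, Finset.sum_eq_single (a := t)
              (f := fun s => |(Pi.single t 1 : Fin m → ℤ) s|)]
          · simp
          · intro s _ hs; simp [hs]
          · simp
      _ ≤ _ := by
          have := hκ1 t
          rw [Fintype.card_fin] at this
          push_cast at this
          linarith
  · simp [sub_smul, Finset.sum_sub_distrib, ← hκ t, Pi.single_apply]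
  · set D : Fin m → Fin (2 * n) × Fin (2 * n) → ℝ :=
      fun t => ∑ s, ((Pi.single t 1 - κ t : Fin m → ℤ) s : ℝ) • sqStep U s with hD
    have hDt : ∀ t, sqStep U t = D t + ∑ s, (κ t s : ℝ) • sqStep U s := by
      intro t
      simp [hD, sub_smul, Finset.sum_sub_distrib, Pi.single_apply]
    set M₀ := Submodule.span ℝ {sq (ind (U 0))}
    set M₁ := Submodule.span ℝ (Set.range fun k : B => sqStep U (b k))
    set M₂ := Submodule.span ℝ (Set.range D)
    have hstep : ∀ t : Fin m, sqStep U t ∈ M₁ ⊔ M₂ := by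
      intro t
      rw [hDt t]
      refine Submodule.add_mem _ (Submodule.mem_sup_right (Submodule.subset_span ⟨t, rfl⟩))
        (Submodule.mem_sup_left (Submodule.sum_mem _ fun s _ => ?_))
      by_cases hs : s ∈ S
      · obtain ⟨k, rfl⟩ := hs
        exact Submodule.smul_mem _ _ (Submodule.subset_span ⟨k, rfl⟩)
      · rw [hκS t s hs]; simp
    have hpt : ∀ t ≤ m, sq (ind (U t)) ∈ M₀ ⊔ (M₁ ⊔ M₂) := by
      intro t
      induction t with
      | zero => exact fun _ => Submodule.mem_sup_left (Submodule.mem_span_singleton_self _)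
      | succ t ih =>
        intro ht
        have e : sq (ind (U (t + 1))) = sq (ind (U t)) + sqStep U (⟨t, ht⟩ : Fin m) := by
          simp [sqStep]
        rw [e]
        exact Submodule.add_mem _ (ih (by omega)) (Submodule.mem_sup_right (hstep _))
    have hle : Submodule.span ℝ (sq '' W) ≤ M₀ ⊔ (M₁ ⊔ M₂) := by
      rw [Submodule.span_le]
      rintro _ ⟨_, ⟨t, ht, rfl⟩, rfl⟩
      exact hpt t (by simp at ht; omega)
    have e1 : sqDim W ≤ _ := Submodule.finrank_mono hle
    have e2 := Submodule.finrank_add_le_finrank_add_finrank M₀ (M₁ ⊔ M₂)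
    have e3 := Submodule.finrank_add_le_finrank_add_finrank M₁ M₂
    have e4 : Module.finrank ℝ M₀ ≤ 1 := (finrank_span_le_card _).trans (by simp)
    have e5 : Module.finrank ℝ M₁ ≤ Fintype.card B := finrank_range_le_card _
    -- All swap vectors have coordinate sum zero, unlike the vectors of the run.
    have e6 : Fintype.card B < linDim W := by
      rw [← finrank_span_eq_card hli, hspan]
      refine Submodule.finrank_lt_finrank_of_lt (lt_of_le_of_ne ?_ ?_)
      · rw [Submodule.span_le]
        rintro _ ⟨t, rfl⟩
        have : swapVec (w t) = ind (U (t + 1)) - ind (U t) := by rw [h.ind_succ t]; abel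
        change swapVec (w t) ∈ _
        rw [this]
        exact Submodule.sub_mem _ (Submodule.subset_span (hmemW _ t.2))
          (Submodule.subset_span (hmemW _ t.2.le))
      · intro heq
        let f : (Fin (2 * n) → ℝ) →ₗ[ℝ] ℝ := ∑ v, LinearMap.proj v
        have hf : Submodule.span ℝ (Set.range fun t => swapVec (w t)) ≤ LinearMap.ker f := by
          rw [Submodule.span_le]
          rintro _ ⟨t, rfl⟩
          change f (swapVec (w t)) = 0
          simp [f, swapVec, LinearMap.sum_apply, Finset.sum_sub_distrib]
        have h1 : f (ind (U 0)) = 0 := hf (heq ▸ Submodule.subset_span (hmemW 0 (by omega)))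
        have h2 : f (ind (U 0)) = ((U 0).card : ℝ) := by
          rw [← sum_ind]
          simp [f, LinearMap.sum_apply]
        rw [h1, show (U 0).card = n from h0] at h2
        have : (n : ℝ) ≠ 0 := by positivity
        exact this h2.symm
    omega

/-- A sequence of swaps determines linearly independent integral linear forms in the weights that
are small whenever all the swaps are improving and gain little, from whatever partition the
run starts. Their number is the excess of the dimension of the squares. -/
theorem IsSwapPath.exists_forms (hn : 1 ≤ n) (h : IsSwapPath w U) (h0 : IsBalanced (U 0)) {r : ℕ}
    (hr : linDim ((fun t => ind (U t)) '' Set.Ico 0 (0 + (m + 1))) + r ≤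
      sqDim ((fun t => ind (U t)) '' Set.Ico 0 (0 + (m + 1)))) :
    ∃ q : Fin r → Edge n → ℤ, LinearIndependent ℝ (fun i e => (q i e : ℝ)) ∧
      ∀ U' : ℕ → Finset (Fin (2 * n)), IsSwapPath w U' → ∀ (X : Weights n) (ε : ℝ), 0 ≤ ε →
        (∀ t : Fin m, |cut X (U' (t + 1)) - cut X (U' t)| ≤ ε) →
          ∀ i, |∑ e, (q i e : ℝ) * X e| ≤ (2 * n + 1) * ε := by
  classical
  obtain ⟨κ, hκ1, hκ0, hdim⟩ := h.exists_relations hn h0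
  obtain ⟨f, hf⟩ := exists_linearIndependent_fin _ (show r ≤ _ by
    exact Nat.le_of_add_le_add_left (hr.trans hdim))
  refine ⟨fun i e => ∑ s, κ (f i) s * (crossing (U (s + 1)) e - crossing (U s) e), ?_, ?_⟩
  · let L : (Edge n → ℝ) →ₗ[ℝ] (Fin (2 * n) × Fin (2 * n) → ℝ) :=
      LinearMap.pi fun ab => if hab : ab.1 ≠ ab.2 then
        (-(1 / 2 : ℝ)) • LinearMap.proj (⟨s(ab.1, ab.2), by simpa using hab⟩ : Edge n) else 0
    refine LinearIndependent.of_comp L ?_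
    suffices hL : (fun t => ∑ s, (κ t s : ℝ) • sqStep U s) ∘ f = L ∘ fun i e =>
        ((∑ s, κ (f i) s * (crossing (U (s + 1)) e - crossing (U s) e) : ℤ) : ℝ) by
      rw [hL] at hf
      exact hf
    symm
    funext i
    funext ⟨a, b⟩
    by_cases hab : a = b
    · subst hab
      simp only [Function.comp_apply]
      rw [h.sum_sqStep_diag (hκ0 _)]
      simp [L]
    · have he := h.sum_crossing_eq (hκ0 (f i)) (e := ⟨s(a, b), by simpa using hab⟩) rfl
      simp only [Function.comp_apply, L, LinearMap.pi_apply, ne_eq, hab, not_false_eq_true,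
        dif_pos, LinearMap.smul_apply, LinearMap.proj_apply, smul_eq_mul]
      push_cast
      rw [he]
      ring
  · intro U' hU' X ε hε0 hε i
    have hq : ∀ e : Edge n, ((∑ s, κ (f i) s * (crossing (U (s + 1)) e - crossing (U s) e) : ℤ) : ℝ)
        = ∑ s, (κ (f i) s : ℝ) * ((crossing (U' (s + 1)) e : ℝ) - crossing (U' s) e) := by
      intro e
      obtain ⟨a, b, he⟩ : ∃ a b, e.1 = s(a, b) := by
        induction e.1 with
        | h a b => exact ⟨a, b, rfl⟩
      rw [hU'.sum_crossing_eq (hκ0 (f i)) he, h.sum_sqStep_eq hU' (hκ0 (f i)),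
        ← h.sum_crossing_eq (hκ0 (f i)) he]
      push_cast
      rfl
    have hsum : ∑ e, ((∑ s, κ (f i) s * (crossing (U (s + 1)) e - crossing (U s) e) : ℤ) : ℝ) * X e
        = ∑ s, (κ (f i) s : ℝ) * (cut X (U' (s + 1)) - cut X (U' s)) := by
      simp only [hq, cut_eq_sum, ← Finset.sum_sub_distrib, Finset.mul_sum, Finset.sum_mul]
      rw [Finset.sum_comm]
      refine Finset.sum_congr rfl fun s _ => Finset.sum_congr rfl fun e _ => ?_
      ring
    rw [hsum]
    calc |∑ s, (κ (f i) s : ℝ) * (cut X (U' (s + 1)) - cut X (U' s))|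
        ≤ ∑ s, |(κ (f i) s : ℝ) * (cut X (U' (s + 1)) - cut X (U' s))| :=
          Finset.abs_sum_le_sum_abs _ _
      _ ≤ ∑ s, |(κ (f i) s : ℝ)| * ε := by
          refine Finset.sum_le_sum fun s _ => ?_
          rw [abs_mul]
          exact mul_le_mul_of_nonneg_left (hε s) (abs_nonneg _)
      _ = ((∑ s, |κ (f i) s| : ℤ) : ℝ) * ε := by
          rw [← Finset.sum_mul]; push_cast; rfl
      _ ≤ (2 * n + 1) * ε := by
          refine mul_le_mul_of_nonneg_right ?_ hε0
          exact_mod_cast hκ1 (f i)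

end Forms

/-! ### Anti-concentration of independent integral linear forms -/

section AntiConcentration

variable {ι : Type*} [Fintype ι]

/-- Marginal densities bounded by `c` give a joint density bounded by `c ^ card ι`. -/
theorem pi_le_smul_volume {μ : ι → Measure ℝ} {c : NNReal}
    (hμ : ∀ i, μ i ≤ c • (volume : Measure ℝ)) :
    Measure.pi μ ≤ (c ^ Fintype.card ι) • (volume : Measure (ι → ℝ)) := by
  have h1 : Measure.pi (fun _ : ι => c • (volume : Measure ℝ)) =
      (c ^ Fintype.card ι) • (volume : Measure (ι → ℝ)) := by
    refine (Measure.pi_eq fun s hs => ?_)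
    rw [Measure.smul_apply, volume_pi_pi]
    simp only [Measure.smul_apply, Finset.prod_const, ENNReal.smul_def, smul_eq_mul,
      Finset.prod_mul_distrib, Finset.card_univ]
    push_cast
    rfl
  rw [← h1]
  refine Measure.le_iff.2 fun s hs => ?_
  rw [Measure.pi, Measure.pi, toMeasure_apply _ _ hs, toMeasure_apply _ _ hs]
  refine OuterMeasure.le_pi.2 (fun t _ => ?_) s
  refine (OuterMeasure.pi_pi_le _ _).trans ?_
  exact Finset.prod_le_prod' fun i _ => hμ i _

/-- A linear change of variables with integral matrix has determinant at least `1` in absolute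
value, so that preimages of cubes are no larger than the cubes. -/
theorem volume_preimage_cube_le {ρ : Type*} [Fintype ρ] [DecidableEq ρ] (M : Matrix ρ ρ ℤ)
    (hM : M.det ≠ 0) (b : ρ → ℝ) (η : ℝ) :
    volume {x : ρ → ℝ | ∀ i, |∑ j, (M i j : ℝ) * x j + b i| ≤ η} ≤
      ENNReal.ofReal (2 * η) ^ Fintype.card ρ := by
  have hdet : (M.map (Int.cast : ℤ → ℝ)).det = (M.det : ℝ) := (Int.cast_det M).symm
  have hdet0 : LinearMap.det (Matrix.toLin' (M.map (Int.cast : ℤ → ℝ))) ≠ 0 := by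
    rw [LinearMap.det_toLin', hdet]
    exact_mod_cast hM
  have hset : {x : ρ → ℝ | ∀ i, |∑ j, (M i j : ℝ) * x j + b i| ≤ η} =
      Matrix.toLin' (M.map (Int.cast : ℤ → ℝ)) ⁻¹'
        (Set.univ.pi fun i => Set.Icc (-η - b i) (η - b i)) := by
    ext x
    simp only [Set.mem_ofPred_eq, Set.mem_preimage, Set.mem_univ_pi, Matrix.toLin'_apply,
      Matrix.mulVec, dotProduct, Matrix.map_apply, Set.mem_Icc, abs_le]
    refine forall_congr' fun i => and_congr ⟨fun h => by linarith, fun h => by linarith⟩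
      ⟨fun h => by linarith, fun h => by linarith⟩
  rw [hset, Measure.addHaar_preimage_linearMap _ hdet0, volume_pi_pi]
  have h1 : ENNReal.ofReal |(LinearMap.det (Matrix.toLin' (M.map (Int.cast : ℤ → ℝ))))⁻¹| ≤ 1 := by
    rw [LinearMap.det_toLin', hdet, abs_inv, ENNReal.ofReal_le_one]
    refine inv_le_one_of_one_le₀ ?_
    rw [← Int.cast_abs]
    exact_mod_cast Int.one_le_abs hM
  calc _ ≤ 1 * ∏ i, volume (Set.Icc (-η - b i) (η - b i)) := by gcongr
    _ = _ := by
      simp only [Real.volume_Icc, one_mul]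
      rw [Finset.prod_congr rfl fun i _ => by
        rw [show η - b i - (-η - b i) = 2 * η by ring], Finset.prod_const, Finset.card_univ]

/-- Linearly independent rows contain a nonsingular square submatrix. -/
theorem exists_submatrix_det_ne_zero {r : ℕ} {q : Fin r → ι → ℤ}
    (hq : LinearIndependent ℝ (fun i e => (q i e : ℝ))) :
    ∃ f : Fin r → ι, Function.Injective f ∧ (Matrix.of fun i j => q i (f j)).det ≠ 0 := by
  let A : Matrix (Fin r) ι ℝ := Matrix.of fun i e => (q i e : ℝ)
  have hrank : A.rank = r := by
    have := LinearIndependent.rank_matrix (M := A) hq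
    rwa [Fintype.card_fin] at this
  obtain ⟨f, hf⟩ := exists_linearIndependent_fin A.col
    (by rw [← Matrix.rank_eq_finrank_span_cols, hrank] : r ≤ _)
  refine ⟨f, fun a b hab => hf.injective (congrArg A.col hab), fun hdet => ?_⟩
  have h1 : LinearIndependent ℝ (A.submatrix id f).col := hf
  rw [Matrix.linearIndependent_cols_iff_isUnit, Matrix.isUnit_iff_isUnit_det] at h1
  have h2 : (A.submatrix id f).det = (((Matrix.of fun i j => q i (f j)).det : ℤ) : ℝ) := by
    rw [Int.cast_det]
    rfl
  rw [h2, hdet] at h1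
  simp at h1

/-- The probability that `r` linearly independent integral linear forms in independent variables
with bounded densities all take values in `[-η, η]` decays like the `r`-th power of `η`: condition
on all variables outside a nonsingular `r × r` minor, whose determinant is at least `1`. -/
theorem measure_forms_le {μ : ι → Measure ℝ} [∀ i, IsProbabilityMeasure (μ i)] {c : NNReal}
    (hμ : ∀ i, μ i ≤ c • (volume : Measure ℝ)) {r : ℕ} {q : Fin r → ι → ℤ}
    (hq : LinearIndependent ℝ (fun i e => (q i e : ℝ))) (η : ℝ) :
    Measure.pi μ {X | ∀ i, |∑ e, (q i e : ℝ) * X e| ≤ η} ≤ (c * ENNReal.ofReal (2 * η)) ^ r := by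
  classical
  obtain ⟨f, hf, hdet⟩ := exists_submatrix_det_ne_zero hq
  obtain ⟨J, g, hg⟩ : ∃ (J : ι → Prop) (g : Fin r ≃ {e // J e}), ∀ i, (g i).1 = f i :=
    ⟨fun e => e ∈ Set.range f, Equiv.ofInjective f hf, fun _ => rfl⟩
  have hmp := measurePreserving_piEquivPiSubtypeProd μ J
  set A : Set (ι → ℝ) := {X | ∀ i, |∑ e, (q i e : ℝ) * X e| ≤ η} with hA
  let A' : Set (({e // J e} → ℝ) × ({e // ¬ J e} → ℝ)) :=
    {z | ∀ i, |∑ e, (q i e.1 : ℝ) * z.1 e + ∑ e, (q i e.1 : ℝ) * z.2 e| ≤ η}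
  have hAA' : A = MeasurableEquiv.piEquivPiSubtypeProd (fun _ : ι => ℝ) J ⁻¹' A' := by
    ext X
    simp only [hA, A', Set.mem_ofPred_eq, Set.mem_preimage]
    refine forall_congr' fun i => ?_
    rw [← Fintype.sum_subtype_add_sum_subtype J fun e => (q i e : ℝ) * X e]
    rfl
  have hA' : MeasurableSet A' := by
    have : A' = ⋂ i, {z | |∑ e, (q i e.1 : ℝ) * z.1 e + ∑ e, (q i e.1 : ℝ) * z.2 e| ≤ η} := by
      ext z; simp [A']
    rw [this]
    refine MeasurableSet.iInter fun i => measurableSet_le ?_ measurable_const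
    fun_prop
  rw [hAA', hmp.measure_preimage_equiv, Measure.prod_apply_symm hA']
  have hinner : ∀ y : {e // ¬ J e} → ℝ,
      Measure.pi (fun i : {e // J e} => μ i) ((fun x => (x, y)) ⁻¹' A') ≤
        (c * ENNReal.ofReal (2 * η)) ^ r := by
    intro y
    have hcard : Fintype.card {e // J e} = r := by
      rw [← Fintype.card_congr g, Fintype.card_fin]
    let M : Matrix {e // J e} {e // J e} ℤ := Matrix.of fun i j => q (g.symm i) j.1
    have hM : M.det ≠ 0 := by
      have : M.submatrix g g = Matrix.of fun i j => q i (f j) := by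
        ext i j
        simp [M, hg]
      rw [← Matrix.det_submatrix_equiv_self g M, this]
      exact hdet
    have hvol := volume_preimage_cube_le M hM
      (fun i => ∑ e : {e // ¬ J e}, (q (g.symm i) e.1 : ℝ) * y e) η
    have hsub : (fun x => (x, y)) ⁻¹' A' ⊆ {x : {e // J e} → ℝ | ∀ i,
        |∑ j, (M i j : ℝ) * x j + ∑ e : {e // ¬ J e}, (q (g.symm i) e.1 : ℝ) * y e| ≤ η} :=
      fun x hx i => hx (g.symm i)
    calc _ ≤ _ := measure_mono hsub
      _ ≤ ((c ^ Fintype.card {e // J e}) • (volume : Measure ({e // J e} → ℝ))) _ :=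
          pi_le_smul_volume (fun i => hμ i.1) _
      _ ≤ _ := by
          rw [Measure.smul_apply, ENNReal.smul_def, smul_eq_mul, mul_pow]
          push_cast
          rw [hcard] at hvol ⊢
          gcongr
  calc _ ≤ ∫⁻ _, (c * ENNReal.ofReal (2 * η)) ^ r ∂(Measure.pi fun i : {e // ¬ J e} => μ i) :=
        lintegral_mono hinner
    _ = _ := by rw [lintegral_const, measure_univ, mul_one]

end AntiConcentration

/-! ### Runs of the algorithm -/

section Runs

variable {n : ℕ}

theorem isBalanced_swapNodes {U : Finset (Fin (2 * n))} {p : Fin (2 * n) × Fin (2 * n)}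
    (hU : IsBalanced U) (h1 : p.1 ∈ U) (h2 : p.2 ∉ U) : IsBalanced (swapNodes U p) := by
  have : p.2 ∉ U.erase p.1 := fun h => h2 (Finset.mem_of_mem_erase h)
  have hpos := Finset.card_pos.2 ⟨_, h1⟩
  unfold IsBalanced swapNodes at *
  rw [Finset.card_insert_of_notMem this, Finset.card_erase_of_mem h1]
  omega

theorem exists_improving {X : Weights n} {U : Finset (Fin (2 * n))} (h : ¬ IsLocalOpt X U) :
    ∃ p, IsImprovingSwap X U p := by
  unfold IsLocalOpt at h
  push Not at h
  exact h

theorem Implementation.run_balanced (A : Implementation n) (X : Weights n) (t : ℕ) :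
    IsBalanced (A.run X t).2 := by
  induction t with
  | zero => exact A.init_balanced X
  | succ t ih =>
    rw [Implementation.run]
    split_ifs with h
    · exact ih
    · have := A.pivot_improving X (A.run X t).1 _ ih h
      exact isBalanced_swapNodes ih this.1 this.2.1

/-- `T` consecutive improving swaps `p 0, …, p (T - 1)` on weights `X`, visiting the balanced
partitions `U 0, …, U T`. -/
structure IsRun (X : Weights n) (T : ℕ) (p : ℕ → Fin (2 * n) × Fin (2 * n))
    (U : ℕ → Finset (Fin (2 * n))) : Prop where
  balanced_zero : IsBalanced (U 0)
  improving : ∀ t < T, IsImprovingSwap X (U t) (p t)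
  succ_eq : ∀ t < T, U (t + 1) = swapNodes (U t) (p t)

theorem Implementation.exists_isRun {A : Implementation n} {X : Weights n} {T : ℕ}
    (h : (T : ℕ∞) ≤ A.steps X) : ∃ p U, IsRun X T p U := by
  have hopt : ∀ t < T, ¬ IsLocalOpt X (A.run X t).2 := by
    intro t ht hloc
    have : (T : ℕ∞) ≤ t := h.trans (iInf₂_le t hloc)
    exact absurd (Nat.cast_le.1 this) (by omega)
  refine ⟨fun t => A.pivot X (A.run X t).1 (A.run X t).2, fun t => (A.run X t).2,
    A.init_balanced X, fun t ht => ?_, fun t ht => ?_⟩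
  · exact A.pivot_improving X _ _ (A.run_balanced X t) (hopt t ht)
  · simp only [Implementation.run]
    rw [if_neg (hopt t ht)]

theorem exists_isRun_of_lt_maxSteps {X : Weights n} {T : ℕ} (h : (T : ℕ∞) < maxSteps X) :
    ∃ p U, IsRun X (T + 1) p U := by
  obtain ⟨A, hA⟩ := lt_iSup_iff.1 h
  refine A.exists_isRun ?_
  push_cast
  exact Order.add_one_le_of_lt hA

namespace IsRun

variable {X : Weights n} {T : ℕ} {p : ℕ → Fin (2 * n) × Fin (2 * n)}
  {U : ℕ → Finset (Fin (2 * n))}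

theorem balanced (h : IsRun X T p U) : ∀ t ≤ T, IsBalanced (U t) := by
  intro t
  induction t with
  | zero => exact fun _ => h.balanced_zero
  | succ t ih =>
    intro ht
    have := h.improving t ht
    rw [h.succ_eq t ht]
    exact isBalanced_swapNodes (ih (by omega)) this.1 this.2.1

theorem cut_succ_lt (h : IsRun X T p U) {t : ℕ} (ht : t < T) :
    cut X (U (t + 1)) < cut X (U t) := by
  rw [h.succ_eq t ht]
  exact (h.improving t ht).2.2

theorem cut_lt (h : IsRun X T p U) {s t : ℕ} (hst : s < t) (ht : t ≤ T) :
    cut X (U t) < cut X (U s) := by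
  induction t, hst using Nat.le_induction with
  | base => exact h.cut_succ_lt ht
  | succ t _ ih => exact (h.cut_succ_lt ht).trans (ih (by omega))

theorem cut_le (h : IsRun X T p U) {s t : ℕ} (hst : s ≤ t) (ht : t ≤ T) :
    cut X (U t) ≤ cut X (U s) := by
  rcases hst.eq_or_lt with rfl | hst
  · exact le_rfl
  · exact (h.cut_lt hst ht).le

theorem ne (h : IsRun X T p U) {s t : ℕ} (hs : s ≤ T) (ht : t ≤ T) (hst : s ≠ t) : U s ≠ U t := by
  intro heq
  rcases lt_or_gt_of_ne hst with hlt | hlt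
  · exact absurd (h.cut_lt hlt ht) (by rw [heq]; exact lt_irrefl _)
  · exact absurd (h.cut_lt hlt hs) (by rw [heq]; exact lt_irrefl _)

/-- A part of a run is a run. -/
theorem shift (h : IsRun X T p U) {a m : ℕ} (ham : a + m ≤ T) :
    IsRun X m (fun t => p (a + t)) (fun t => U (a + t)) :=
  ⟨h.balanced a (by omega), fun t ht => h.improving (a + t) (by omega),
    fun t ht => h.succ_eq (a + t) (by omega)⟩

theorem isSwapPath (h : IsRun X T p U) : IsSwapPath (fun t : Fin T => p t) U := fun t =>
  ⟨(h.improving t t.2).1, (h.improving t t.2).2.1, h.succ_eq t t.2⟩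

theorem length_lt (h : IsRun X T p U) : T < 2 ^ (2 * n) := by
  have hinj : Function.Injective fun t : Fin (T + 1) => U t := by
    intro s t hst
    by_contra hne
    exact h.ne (by omega) (by omega) (fun h => hne (Fin.ext h)) hst
  have := Fintype.card_le_of_injective _ hinj
  rw [Fintype.card_fin, Fintype.card_finset, Fintype.card_fin] at this
  omega

end IsRun

theorem maxSteps_lt (X : Weights n) : maxSteps X < (2 ^ (2 * n) : ℕ) := by
  by_contra! h
  have h1 : 0 < 2 ^ (2 * n) := by positivity
  obtain ⟨p, U, hU⟩ := exists_isRun_of_lt_maxSteps (T := 2 ^ (2 * n) - 1)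
    (lt_of_lt_of_le (Nat.cast_lt.2 (by omega)) h)
  have := hU.length_lt
  omega

/-- On two nodes both balanced partitions have the same cut. -/
theorem maxSteps_eq_zero (X : Weights 1) : maxSteps X = 0 := by
  by_contra h
  obtain ⟨p, U, hU⟩ := exists_isRun_of_lt_maxSteps (T := 0) (by simpa [pos_iff_ne_zero] using h)
  have key : ∀ W : Finset (Fin (2 * 1)), W.card = 1 → ∀ a b, a ≠ b →
      (a ∈ W ∧ b ∉ W) ∨ (b ∈ W ∧ a ∉ W) := by decide
  have hcut : ∀ W : Finset (Fin (2 * 1)), IsBalanced W → cut X W = ∑ e, X e := by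
    intro W hW
    refine Finset.sum_congr rfl fun e _ => ?_
    rw [if_pos]
    obtain ⟨e, he⟩ := e
    induction e with
    | h a b =>
      rcases key W hW a b (by simpa using he) with h | h
      · exact ⟨a, b, rfl, h⟩
      · exact ⟨b, a, Sym2.eq_swap, h⟩
  have h1 := hU.cut_succ_lt (t := 0) (by omega)
  rw [hcut _ (hU.balanced 0 (by omega)), hcut _ (hU.balanced 1 (by omega))] at h1
  exact lt_irrefl _ h1

end Runs

/-! ### Measurability of the number of steps -/

section Measurability

variable {n : ℕ}

theorem measurable_cut (U : Finset (Fin (2 * n))) : Measurable fun X : Weights n => cut X U := by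
  simp only [cut_eq_sum]
  fun_prop

theorem maxSteps_le_of_forall_iff {X Y : Weights n}
    (h : ∀ U p, IsImprovingSwap X U p ↔ IsImprovingSwap Y U p) : maxSteps X ≤ maxSteps Y := by
  classical
  have hopt : ∀ U, IsLocalOpt X U ↔ IsLocalOpt Y U := fun U =>
    forall_congr' fun p => not_congr (h U p)
  refine iSup_le fun A => ?_
  -- An implementation that runs on `Y` as `A` does on `X`.
  let A' : Implementation n :=
    { init := fun _ => A.init X
      init_balanced := fun _ => A.init_balanced X
      pivot := fun Z past U =>
        if IsImprovingSwap Z U (A.pivot X past U) then A.pivot X past U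
        else if h : ∃ p, IsImprovingSwap Z U p then h.choose else A.pivot X past U
      pivot_improving := fun Z past U _ hZ => by
        have hex := exists_improving hZ
        split_ifs with h1
        · exact h1
        · exact hex.choose_spec }
  have hrun : ∀ t, A'.run Y t = A.run X t := by
    intro t
    induction t with
    | zero => rfl
    | succ t ih =>
      rw [Implementation.run, Implementation.run, ih]
      by_cases hl : IsLocalOpt X (A.run X t).2
      · rw [if_pos hl, if_pos ((hopt _).1 hl)]
      · rw [if_neg hl, if_neg (fun h => hl ((hopt _).2 h))]
        have := A.pivot_improving X (A.run X t).1 _ (A.run_balanced X t) hl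
        have hp : A'.pivot Y (A.run X t).1 (A.run X t).2 =
            A.pivot X (A.run X t).1 (A.run X t).2 := if_pos ((h _ _).1 this)
        rw [hp]
  have hsteps : A.steps X = A'.steps Y := by
    simp only [Implementation.steps, hrun, hopt]
  rw [hsteps]
  exact le_iSup (fun A : Implementation n => A.steps Y) A'

/-- The number of steps depends only on which of the finitely many conceivable swaps are
improving. -/
theorem measurable_maxSteps :
    Measurable fun X : Weights n => ((maxSteps X : ℕ∞) : ℝ≥0∞) := by
  let Φ : Weights n → (Finset (Fin (2 * n)) × (Fin (2 * n) × Fin (2 * n)) → Prop) :=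
    fun X s => IsImprovingSwap X s.1 s.2
  have hΦ : Measurable Φ := by
    refine measurable_pi_iff.2 fun s => measurableSet_setOfPred.1 ?_
    have : {X : Weights n | Φ X s} =
        {X | s.2.1 ∈ s.1 ∧ s.2.2 ∉ s.1} ∩ {X | cut X (swapNodes s.1 s.2) < cut X s.1} := by
      ext X
      simp only [Φ, IsImprovingSwap, Set.mem_ofPred_eq, Set.mem_inter_iff, and_assoc]
    rw [this]
    exact (MeasurableSet.const _).inter (measurableSet_lt (measurable_cut _) (measurable_cut _))
  have hfac : (fun X : Weights n => ((maxSteps X : ℕ∞) : ℝ≥0∞)).FactorsThrough Φ := by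
    intro X Y hXY
    have h : ∀ U p, IsImprovingSwap X U p ↔ IsImprovingSwap Y U p := fun U p =>
      iff_of_eq (congrFun hXY (U, p))
    have : maxSteps X = maxSteps Y := le_antisymm (maxSteps_le_of_forall_iff h)
      (maxSteps_le_of_forall_iff fun U p => (h U p).symm)
    simp only [this]
  rw [← hfac.extend_comp (e' := fun _ => 0)]
  exact (measurable_of_finite _).comp hΦ

end Measurability

/-! ### The probability of a long run with little gain -/

section Probability

variable {n : ℕ}

theorem IsSmoothed.le_smul_volume {φ : ℝ} {ν : Measure ℝ} (h : IsSmoothed φ ν) :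
    ν ≤ φ.toNNReal • (volume : Measure ℝ) := by
  obtain ⟨-, -, f, -, hf, rfl⟩ := h
  calc volume.withDensity f ≤ volume.withDensity fun _ => ENNReal.ofReal φ :=
        withDensity_mono (ae_of_all _ hf)
    _ = _ := by rw [withDensity_const]; rfl

/-- A density on `[-1, 1]` cannot be bounded by less than `1 / 2`. -/
theorem IsSmoothed.half_le {φ : ℝ} {ν : Measure ℝ} (h : IsSmoothed φ ν) : 1 / 2 ≤ φ := by
  have := h.1
  have h1 : ν (Set.Icc (-1) 1) = 1 := (prob_compl_eq_zero_iff measurableSet_Icc).1 h.2.1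
  have h2 : ν (Set.Icc (-1) 1) ≤ (φ.toNNReal • (volume : Measure ℝ)) (Set.Icc (-1) 1) :=
    h.le_smul_volume _
  rw [h1, Measure.smul_apply, Real.volume_Icc, ENNReal.smul_def, smul_eq_mul] at h2
  change 1 ≤ ENNReal.ofReal φ * _ at h2
  rw [← ENNReal.ofReal_mul' (by norm_num), ENNReal.one_le_ofReal] at h2
  linarith

/-- The weights on which some run of `m` swaps gains at most `ε`, while the squares of its vectors
span at least `r` dimensions more than the vectors. -/
def lowGainSet (n m r : ℕ) (ε : ℝ) : Set (Weights n) :=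
  {X | ∃ p U, IsRun X m p U ∧
    linDim ((fun t => ind (U t)) '' Set.Ico 0 (0 + (m + 1))) + r ≤
      sqDim ((fun t => ind (U t)) '' Set.Ico 0 (0 + (m + 1))) ∧
    cut X (U 0) - cut X (U m) ≤ ε}

variable {φ : ℝ} {μ : Edge n → Measure ℝ}

/-- For each sequence of swaps, the run gains little only if the associated linear forms are all
small. The forms do not depend on the initial partition, so that the union bound ranges over
the sequences of swaps only. -/
theorem measure_lowGainSet_le (hn : 1 ≤ n) (hμ : ∀ e, IsSmoothed φ (μ e)) (m r : ℕ) {ε : ℝ}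
    (hε : 0 ≤ ε) :
    Measure.pi μ (lowGainSet n m r ε) ≤
      ((2 * n) ^ 2 : ℕ) ^ m * (ENNReal.ofReal (φ * (2 * ((2 * n + 1) * ε)))) ^ r := by
  have hprob : ∀ e, IsProbabilityMeasure (μ e) := fun e => (hμ e).1
  let A : (Fin m → Fin (2 * n) × Fin (2 * n)) → Set (Weights n) := fun w =>
    {X | ∃ p U, IsRun X m p U ∧ (fun t : Fin m => p t) = w ∧
      linDim ((fun t => ind (U t)) '' Set.Ico 0 (0 + (m + 1))) + r ≤
        sqDim ((fun t => ind (U t)) '' Set.Ico 0 (0 + (m + 1))) ∧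
      cut X (U 0) - cut X (U m) ≤ ε}
  have hcover : lowGainSet n m r ε ⊆ ⋃ w, A w := by
    rintro X ⟨p, U, h1, h2, h3⟩
    exact Set.mem_iUnion.2 ⟨_, p, U, h1, rfl, h2, h3⟩
  have hA : ∀ w, Measure.pi μ (A w) ≤ (ENNReal.ofReal (φ * (2 * ((2 * n + 1) * ε)))) ^ r := by
    intro w
    rcases (A w).eq_empty_or_nonempty with hemp | ⟨X₀, p₀, U₀, h1, hw, h2, -⟩
    · rw [hemp, measure_empty]; exact zero_le
    have hpath := h1.isSwapPath
    rw [hw] at hpath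
    obtain ⟨q, hq, hforms⟩ := hpath.exists_forms hn h1.balanced_zero h2
    have hsub : A w ⊆ {X | ∀ i, |∑ e, (q i e : ℝ) * X e| ≤ (2 * n + 1) * ε} := by
      rintro X ⟨p, U, hU, rfl, -, hgain⟩
      refine hforms U hU.isSwapPath X ε hε fun t => ?_
      have e1 := hU.cut_succ_lt t.2
      have e2 := hU.cut_le (Nat.zero_le t) t.2.le
      have e3 := hU.cut_le (Nat.succ_le_of_lt t.2) le_rfl
      rw [abs_le]
      simp only [Nat.succ_eq_add_one] at e3
      constructor <;> linarith
    refine (measure_mono hsub).trans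
      ((measure_forms_le (fun e => (hμ e).le_smul_volume) hq _).trans_eq ?_)
    have hφ : 0 ≤ φ := by
      have := (hμ ⟨s(⟨0, by omega⟩, ⟨1, by omega⟩), by simp⟩).half_le
      linarith
    rw [ENNReal.ofReal_mul hφ]
    rfl
  calc _ ≤ Measure.pi μ (⋃ w, A w) := measure_mono hcover
    _ ≤ ∑ w, Measure.pi μ (A w) := measure_iUnion_fintype_le _ _
    _ ≤ ∑ _w : Fin m → Fin (2 * n) × Fin (2 * n),
        (ENNReal.ofReal (φ * (2 * ((2 * n + 1) * ε)))) ^ r := Finset.sum_le_sum fun w _ => hA w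
    _ = _ := by
      rw [Finset.sum_const, Finset.card_univ, Fintype.card_fun, Fintype.card_prod,
        Fintype.card_fin, Fintype.card_fin, nsmul_eq_mul]
      push_cast
      ring

/-- The weights on which some run of `m` swaps gains at most `ε`. -/
def stallSet (n m : ℕ) (ε : ℝ) : Set (Weights n) :=
  {X | ∃ p U, IsRun X m p U ∧ cut X (U 0) - cut X (U m) ≤ ε}

/-- A run of `2 ^ k` points contains a dyadic window with a large excess of dimension, and a window
gains no more than the whole run. -/
theorem stallSet_subset (hn : 1 ≤ n) {k : ℕ} (hk : 4 * n < 2 ^ k) (ε : ℝ) :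
    stallSet n (2 ^ k - 1) ε ⊆
      ⋃ i ∈ Finset.range k, lowGainSet n (2 ^ (i + 1) - 1) (2 ^ (i + 1) / (4 * k) + 1) ε := by
  rintro X ⟨p, U, hU, hgain⟩
  have hk0 : 0 < k := by
    rcases Nat.eq_zero_or_pos k with rfl | h
    · rw [pow_zero] at hk; omega
    · exact h
  have hpos : 0 < 2 ^ k := by positivity
  obtain ⟨i, hi, a, ha, hdim⟩ := exists_window (P := fun t => ind (U t)) hk0
    (fun s t hs ht hst c => ind_ne_smul hn (hU.balanced s (by omega)) (hU.balanced t (by omega))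
      (hU.ne (by omega) (by omega) hst) c)
    (fun s hs => ind_ne_zero hn (hU.balanced s (by omega)))
    (by rw [Fintype.card_fin]; omega)
  have hpos' : 0 < 2 ^ (i + 1) := by positivity
  set ℓ := 2 ^ (i + 1) with hℓ
  simp only [Set.mem_iUnion, Finset.mem_range]
  have himg : (fun t => ind (U t)) '' Set.Ico a (a + ℓ) =
      (fun t => ind (U (a + t))) '' Set.Ico 0 (0 + (ℓ - 1 + 1)) := by
    rw [zero_add, Nat.sub_add_cancel hpos', ← Set.image_image (fun t => ind (U t)) (fun t => a + t),
      Set.image_const_add_Ico, add_zero]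
  rw [himg] at hdim
  refine ⟨i, hi, _, _, hU.shift (a := a) (m := ℓ - 1) (by omega), ?_, ?_⟩
  · set h₁ := linDim ((fun t => ind (U (a + t))) '' Set.Ico 0 (0 + (ℓ - 1 + 1)))
    set h₂ := sqDim ((fun t => ind (U (a + t))) '' Set.Ico 0 (0 + (ℓ - 1 + 1)))
    have h12 : h₁ ≤ h₂ := by
      by_contra! hlt
      have := Nat.mul_le_mul_left (4 * k) hlt.le
      omega
    have : ℓ / (4 * k) < h₂ - h₁ := by
      rw [Nat.div_lt_iff_lt_mul (by omega), Nat.mul_comm, Nat.mul_sub]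
      omega
    change h₁ + (ℓ / (4 * k) + 1) ≤ h₂
    omega
  · have e1 := hU.cut_le (Nat.zero_le a) (by omega)
    have e2 := hU.cut_le (s := a + (ℓ - 1)) (t := 2 ^ k - 1) (by omega) le_rfl
    simp only [add_zero]
    linarith

theorem measure_stallSet_le (hn : 1 ≤ n) (hμ : ∀ e, IsSmoothed φ (μ e)) {k : ℕ}
    (hk : 4 * n < 2 ^ k) {ε : ℝ} (hε : 0 ≤ ε) :
    Measure.pi μ (stallSet n (2 ^ k - 1) ε) ≤
      k * (((2 * n) ^ 2 : ℕ) ^ (4 * k) * ENNReal.ofReal (φ * (2 * ((2 * n + 1) * ε)))) := by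
  have hprob : ∀ e, IsProbabilityMeasure (μ e) := fun e => (hμ e).1
  have hk0 : 0 < k := by
    rcases Nat.eq_zero_or_pos k with rfl | h
    · rw [pow_zero] at hk; omega
    · exact h
  set x := ENNReal.ofReal (φ * (2 * ((2 * n + 1) * ε)))
  set N : ℝ≥0∞ := (((2 * n) ^ 2 : ℕ) : ℝ≥0∞) with hN
  have hN1 : 1 ≤ N := by
    rw [hN]; exact_mod_cast Nat.one_le_pow _ _ (by omega)
  -- A window of `ℓ < 4 k r` points costs a factor `N ^ ℓ ≤ N ^ (4 k r)` in the union bound and has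
  -- probability at most `x ^ r` for each sequence of swaps.
  rcases le_or_gt 1 (N ^ (4 * k) * x) with hβ | hβ
  · calc _ ≤ (1 : ℝ≥0∞) := prob_le_one
      _ ≤ N ^ (4 * k) * x := hβ
      _ ≤ _ := le_mul_of_one_le_left' (by exact_mod_cast hk0)
  calc _ ≤ Measure.pi μ (⋃ i ∈ Finset.range k,
        lowGainSet n (2 ^ (i + 1) - 1) (2 ^ (i + 1) / (4 * k) + 1) ε) :=
        measure_mono (stallSet_subset hn hk ε)
    _ ≤ ∑ i ∈ Finset.range k, Measure.pi μ
        (lowGainSet n (2 ^ (i + 1) - 1) (2 ^ (i + 1) / (4 * k) + 1) ε) :=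
        measure_biUnion_finset_le _ _
    _ ≤ ∑ i ∈ Finset.range k, N ^ (4 * k) * x := by
        refine Finset.sum_le_sum fun i _ => ?_
        set r := 2 ^ (i + 1) / (4 * k) + 1 with hr
        have hlt : 2 ^ (i + 1) < 4 * k * r := Nat.lt_mul_div_succ _ (by omega)
        calc _ ≤ N ^ (2 ^ (i + 1) - 1) * x ^ r := measure_lowGainSet_le hn hμ _ _ hε
          _ ≤ N ^ (4 * k * r) * x ^ r := by
              gcongr
              omega
          _ = (N ^ (4 * k) * x) ^ r := by rw [pow_mul, mul_pow]
          _ ≤ N ^ (4 * k) * x := pow_le_of_le_one zero_le hβ.le (Nat.succ_ne_zero _)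
    _ = _ := by rw [Finset.sum_const, Finset.card_range, nsmul_eq_mul]

end Probability

/-! ### Tail bounds for the number of steps -/

section Tail

variable {n : ℕ}

theorem card_edge_le : Fintype.card (Edge n) ≤ 2 * n ^ 2 := by
  have h : Fintype.card (Edge n) = (2 * n).choose 2 := by
    rw [← SimpleGraph.edgeFinset_card, SimpleGraph.card_edgeFinset_top_eq_card_choose_two,
      Fintype.card_fin]
  rw [h, Nat.choose_two_right]
  refine Nat.div_le_of_le_mul ?_
  calc 2 * n * (2 * n - 1) ≤ 2 * n * (2 * n) := Nat.mul_le_mul_left _ (Nat.sub_le _ _)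
    _ = _ := by ring

theorem abs_cut_le {X : Weights n} (hX : ∀ e, X e ∈ Set.Icc (-1 : ℝ) 1)
    (U : Finset (Fin (2 * n))) : |cut X U| ≤ 2 * n ^ 2 := by
  calc |cut X U| ≤ ∑ e : Edge n, (1 : ℝ) := by
        refine (Finset.abs_sum_le_sum_abs _ _).trans (Finset.sum_le_sum fun e _ => ?_)
        split_ifs
        · exact abs_le.2 (hX e)
        · simp
    _ = Fintype.card (Edge n) := by simp
    _ ≤ _ := by exact_mod_cast card_edge_le

/-- A run of `T` steps splits into `T / L` blocks of `L` steps, one of which gains at most the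
average. -/
theorem mem_stallSet_of_isRun {X : Weights n} (hX : ∀ e, X e ∈ Set.Icc (-1 : ℝ) 1) {T L : ℕ}
    (hL : 0 < L) (hT : L ≤ T) {p : ℕ → Fin (2 * n) × Fin (2 * n)}
    {U : ℕ → Finset (Fin (2 * n))} (hU : IsRun X T p U) :
    X ∈ stallSet n (L - 1) (8 * n ^ 2 * L / T) := by
  by_contra hcon
  set ε : ℝ := 8 * n ^ 2 * L / T with hε
  have hblock : ∀ a, a + L ≤ T → ε < cut X (U a) - cut X (U (a + L)) := by
    intro a ha
    by_contra! hle
    refine hcon ⟨_, _, hU.shift (a := a) (m := L - 1) (by omega), ?_⟩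
    have := hU.cut_le (s := a + (L - 1)) (t := a + L) (by omega) ha
    simp only [add_zero]
    linarith
  have hsum : ∀ j : ℕ, j * L ≤ T → j * ε ≤ cut X (U 0) - cut X (U (j * L)) := by
    intro j
    induction j with
    | zero => simp
    | succ j ih =>
      intro hj
      rw [Nat.succ_mul] at hj ⊢
      have e1 := ih (by omega)
      have e2 := hblock (j * L) hj
      push_cast
      linarith
  obtain ⟨j, hj⟩ : ∃ j, T / L = j + 1 :=
    ⟨T / L - 1, (Nat.sub_add_cancel (Nat.div_pos hT hL)).symm⟩
  have hjT : (j + 1) * L ≤ T := hj ▸ Nat.div_mul_le_self T L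
  have hTj : T < (j + 2) * L := by
    have := Nat.lt_mul_div_succ T hL
    rw [hj] at this
    linarith
  have e1 := hsum j (by rw [Nat.succ_mul] at hjT; omega)
  have e2 := hblock (j * L) (by rw [Nat.succ_mul] at hjT; omega)
  have e3 := abs_le.1 (abs_cut_le hX (U 0))
  have e4 := abs_le.1 (abs_cut_le hX (U (j * L + L)))
  have hT0 : (0 : ℝ) < T := by exact_mod_cast lt_of_lt_of_le hL hT
  have e5 : (j + 1) * ε < 4 * n ^ 2 := by linarith [e3.2, e4.1]
  have e6 : (T : ℝ) ≤ 2 * ((j + 1) * L) := by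
    have : T ≤ 2 * ((j + 1) * L) := by nlinarith
    exact_mod_cast this
  rw [hε, ← mul_div_assoc, div_lt_iff₀ hT0] at e5
  nlinarith [sq_nonneg (n : ℝ)]

/-- The binary logarithm of the number of points in the windows of a run in which the gain is
bounded from below: the offset `3` ensures that `4 * n < 2 ^ level n`. -/
def level (n : ℕ) : ℕ := Nat.log 2 n + 3

theorem four_mul_lt_two_pow_level (n : ℕ) : 4 * n < 2 ^ level n := by
  have := Nat.lt_pow_succ_log_self (b := 2) (by norm_num) n
  rw [level, show Nat.log 2 n + 3 = (Nat.log 2 n).succ + 2 by omega, pow_add]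
  omega

/-- The factor `n ^ O(log n)` in the tail bound `P(maxSteps ≥ T) ≤ φ * tailConst n / T`. -/
def tailConst (n : ℕ) : ℕ :=
  level n * ((2 * n) ^ 2) ^ (4 * level n) * (16 * n ^ 2 * (2 * n + 1) * 2 ^ level n)

variable {φ : ℝ} {μ : Edge n → Measure ℝ}

theorem measure_le_maxSteps_le (hn : 1 ≤ n) (hμ : ∀ e, IsSmoothed φ (μ e)) {T : ℕ} (hT : 0 < T) :
    Measure.pi μ {X | (T : ℕ∞) ≤ maxSteps X} ≤ ENNReal.ofReal (φ * tailConst n / T) := by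
  have hprob : ∀ e, IsProbabilityMeasure (μ e) := fun e => (hμ e).1
  have hφ : 1 / 2 ≤ φ := (hμ ⟨s(⟨0, by omega⟩, ⟨1, by omega⟩), by simp⟩).half_le
  set k := level n with hk
  have hT0 : (0 : ℝ) < T := by exact_mod_cast hT
  -- For short runs the claimed bound is at least `1`, because `φ ≥ 1 / 2`.
  rcases lt_or_ge T (2 ^ k) with hlt | hge
  · refine prob_le_one.trans ?_
    rw [ENNReal.one_le_ofReal, le_div_iff₀ hT0]
    have h1 : 2 * 2 ^ k ≤ tailConst n := by
      have hk1 : 1 ≤ k := by rw [hk, level]; omega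
      have h2 : 1 ≤ ((2 * n) ^ 2) ^ (4 * k) := Nat.one_le_pow _ _ (by positivity)
      have h3 : 1 ≤ n ^ 2 := Nat.one_le_pow _ _ hn
      calc 2 * 2 ^ k ≤ 1 * 1 * (16 * 1 * (2 * 0 + 1) * 2 ^ k) := by
            have : 0 < 2 ^ k := by positivity
            omega
        _ ≤ tailConst n := by
            unfold tailConst
            gcongr
            omega
    have h2 : (2 * T : ℝ) ≤ tailConst n := by
      have : 2 * T ≤ tailConst n := by omega
      exact_mod_cast this
    nlinarith
  · have hae : ∀ᵐ X ∂(Measure.pi μ), ∀ e, X e ∈ Set.Icc (-1 : ℝ) 1 := by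
      refine ae_all_iff.2 fun e => ?_
      have : ∀ᵐ x ∂(μ e), x ∈ Set.Icc (-1 : ℝ) 1 := (hμ e).2.1
      exact (Measure.tendsto_eval_ae_ae (μ := μ) (i := e)).eventually this
    have hsub : {X | (T : ℕ∞) ≤ maxSteps X} ≤ᵐ[Measure.pi μ]
        stallSet n (2 ^ k - 1) (8 * n ^ 2 * (2 ^ k : ℕ) / T) := by
      filter_upwards [hae] with X hX hTX
      obtain ⟨p, U, hU⟩ := exists_isRun_of_lt_maxSteps (X := X) (T := T - 1)
        (lt_of_lt_of_le (Nat.cast_lt.2 (by omega)) hTX)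
      rw [Nat.sub_add_cancel hT] at hU
      exact mem_stallSet_of_isRun hX (by positivity) hge hU
    refine (measure_mono_ae hsub).trans
      ((measure_stallSet_le hn hμ (four_mul_lt_two_pow_level n) (by positivity)).trans_eq ?_)
    rw [← ENNReal.ofReal_natCast, ← ENNReal.ofReal_natCast, ← ENNReal.ofReal_pow (by positivity),
      ← ENNReal.ofReal_mul (by positivity), ← ENNReal.ofReal_mul (by positivity)]
    congr 1
    rw [tailConst]
    push_cast
    ring

end Tail

/-! ### Quasipolynomial bounds -/

theorem tailConst_mul_le_two_pow (n : ℕ) :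
    tailConst n * (4 * n) * n ≤ 2 ^ (67 * (Nat.log 2 n + 1) ^ 2) := by
  set a := Nat.log 2 n + 1 with ha
  have hn : n ≤ 2 ^ a := (Nat.lt_pow_succ_log_self (by norm_num) n).le
  have h1 : 1 ≤ 2 ^ a := Nat.one_le_two_pow
  have hlev : level n = a + 2 := rfl
  have hlevel : a + 2 ≤ 2 ^ (a + 2) := Nat.lt_two_pow_self.le
  have hsq : ((2 * n) ^ 2) ^ (4 * (a + 2)) ≤ 2 ^ ((2 * a + 2) * (4 * (a + 2))) := by
    rw [pow_mul 2]
    refine Nat.pow_le_pow_left ?_ _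
    calc (2 * n) ^ 2 ≤ (2 * 2 ^ a) ^ 2 := Nat.pow_le_pow_left (Nat.mul_le_mul_left 2 hn) 2
      _ = 2 ^ (2 * a + 2) := by ring
  rw [tailConst, hlev]
  generalize ((2 * n) ^ 2) ^ (4 * (a + 2)) = Y at hsq
  calc (a + 2) * Y * (16 * n ^ 2 * (2 * n + 1) * 2 ^ (a + 2)) * (4 * n) * n
      ≤ 2 ^ (a + 2) * 2 ^ ((2 * a + 2) * (4 * (a + 2))) *
        (16 * (2 ^ a) ^ 2 * (2 * 2 ^ a + 2 * 2 ^ a) * 2 ^ (a + 2)) * (4 * 2 ^ a) * 2 ^ a := by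
        gcongr
        omega
    _ = 2 ^ (8 * a ^ 2 + 31 * a + 28) := by ring
    _ ≤ _ := by
        refine Nat.pow_le_pow_right (by norm_num) ?_
        have : 1 ≤ a := by omega
        nlinarith

/-- The exponent of the step bound is large enough for the tail bound, already for two nodes in
each part. -/
theorem tailConst_mul_le_rpow {n : ℕ} (hn : 2 ≤ n) :
    (tailConst n : ℝ) * (4 * n) * n ≤ (n : ℝ) ^ ((67 * 4 ^ 11 : ℝ) * Real.log n ^ 10) := by
  set a := Nat.log 2 n + 1 with ha
  have ha2 : 2 ≤ a := by
    have := Nat.log_pos (b := 2) (by norm_num) hn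
    omega
  have hn0 : (0 : ℝ) < n := by positivity
  have hlog2 : (1 / 2 : ℝ) ≤ Real.log 2 := by linarith [Real.log_two_gt_d9]
  have hlog2' : Real.log 2 ≤ 1 := by linarith [Real.log_two_lt_d9]
  have hlog : (a / 4 : ℝ) ≤ Real.log n := by
    have h1 : ((2 : ℝ) ^ (Nat.log 2 n)) ≤ n := by
      exact_mod_cast Nat.pow_log_le_self 2 (by omega)
    have h2 := Real.log_le_log (by positivity) h1
    rw [Real.log_pow] at h2
    have h3 : (a : ℝ) / 2 ≤ (Nat.log 2 n : ℝ) := by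
      have : a ≤ 2 * Nat.log 2 n := by omega
      have : (a : ℝ) ≤ 2 * (Nat.log 2 n : ℝ) := by exact_mod_cast this
      linarith
    nlinarith
  have ha0 : (2 : ℝ) ≤ a := by exact_mod_cast ha2
  have h1 : (tailConst n : ℝ) * (4 * n) * n ≤ 2 ^ (67 * a ^ 2) := by
    exact_mod_cast tailConst_mul_le_two_pow n
  refine h1.trans ?_
  rw [← Real.exp_log (show (0 : ℝ) < 2 ^ (67 * a ^ 2) by positivity), Real.log_pow,
    Real.rpow_def_of_pos hn0, Real.exp_le_exp]
  push_cast
  calc 67 * (a : ℝ) ^ 2 * Real.log 2 ≤ 67 * (a : ℝ) ^ 2 * 1 := by gcongr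
    _ ≤ 67 * (a : ℝ) ^ 11 := by
        rw [mul_one]
        gcongr
        · linarith
        · norm_num
    _ = (67 * 4 ^ 11) * (a / 4 : ℝ) ^ 11 := by ring
    _ ≤ (67 * 4 ^ 11) * Real.log n ^ 11 := by gcongr
    _ = _ := by ring

/-! ### The expected number of steps -/

theorem natCast_le_sum_dyadic {M J : ℕ} (hM : M < 2 ^ J) :
    (M : ℝ≥0∞) ≤ ∑ j ∈ Finset.range J, if 2 ^ j ≤ M then (2 ^ (j + 1) : ℝ≥0∞) else 0 := by
  rcases Nat.eq_zero_or_pos M with rfl | hpos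
  · simp
  have h1 : Nat.log 2 M < J := (Nat.log_lt_iff_lt_pow (by norm_num) hpos.ne').2 hM
  calc (M : ℝ≥0∞) ≤ (2 ^ (Nat.log 2 M + 1) : ℝ≥0∞) := by
        exact_mod_cast (Nat.lt_pow_succ_log_self (by norm_num) M).le
    _ = if 2 ^ Nat.log 2 M ≤ M then (2 ^ (Nat.log 2 M + 1) : ℝ≥0∞) else 0 :=
        (if_pos (Nat.pow_log_le_self 2 hpos.ne')).symm
    _ ≤ _ := Finset.single_le_sum
        (f := fun j => if 2 ^ j ≤ M then (2 ^ (j + 1) : ℝ≥0∞) else 0)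
        (fun _ _ => zero_le) (Finset.mem_range.2 h1)

variable {n : ℕ} {φ : ℝ} {μ : Edge n → Measure ℝ}

theorem measurableSet_le_maxSteps (T : ℕ) :
    MeasurableSet {X : Weights n | (T : ℕ∞) ≤ maxSteps X} := by
  have : {X : Weights n | (T : ℕ∞) ≤ maxSteps X} =
      {X | (T : ℝ≥0∞) ≤ ((maxSteps X : ℕ∞) : ℝ≥0∞)} := by
    ext X
    rw [Set.mem_ofPred_eq, Set.mem_ofPred_eq, ← ENat.toENNReal_le, ENat.toENNReal_coe]
  rw [this]
  exact measurableSet_le measurable_const measurable_maxSteps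

/-- The tail bound of order `1 / T` costs a factor `O(n)` in expectation, since only the `2 * n`
dyadic values of `T` below the maximal length `2 ^ (2 * n)` of a run matter. -/
theorem lintegral_maxSteps_le (hn : 1 ≤ n) (hμ : ∀ e, IsSmoothed φ (μ e)) :
    ∫⁻ X, ((maxSteps X : ℕ∞) : ℝ≥0∞) ∂(Measure.pi μ) ≤
      ENNReal.ofReal (φ * (tailConst n * (4 * n))) := by
  have hpt : ∀ X : Weights n, ((maxSteps X : ℕ∞) : ℝ≥0∞) ≤ ∑ j ∈ Finset.range (2 * n),
      {X : Weights n | ((2 ^ j : ℕ) : ℕ∞) ≤ maxSteps X}.indicator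
        (fun _ => (2 ^ (j + 1) : ℝ≥0∞)) X := by
    intro X
    have hlt := maxSteps_lt X
    obtain ⟨M, hM⟩ := ENat.ne_top_iff_exists.1 hlt.ne_top
    rw [← hM, Nat.cast_lt] at hlt
    rw [← hM, ENat.toENNReal_coe]
    refine (natCast_le_sum_dyadic hlt).trans_eq (Finset.sum_congr rfl fun j _ => ?_)
    rw [Set.indicator_apply]
    refine if_congr ?_ rfl rfl
    rw [Set.mem_ofPred_eq, ← hM, Nat.cast_le]
  calc _ ≤ ∫⁻ X, ∑ j ∈ Finset.range (2 * n),
        {X : Weights n | ((2 ^ j : ℕ) : ℕ∞) ≤ maxSteps X}.indicator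
          (fun _ => (2 ^ (j + 1) : ℝ≥0∞)) X ∂(Measure.pi μ) := lintegral_mono hpt
    _ = ∑ j ∈ Finset.range (2 * n), (2 ^ (j + 1) : ℝ≥0∞) *
        Measure.pi μ {X : Weights n | ((2 ^ j : ℕ) : ℕ∞) ≤ maxSteps X} := by
        rw [lintegral_finsetSum _ fun j _ =>
          measurable_const.indicator (measurableSet_le_maxSteps _)]
        exact Finset.sum_congr rfl fun j _ =>
          lintegral_indicator_const (measurableSet_le_maxSteps _) _
    _ ≤ ∑ _j ∈ Finset.range (2 * n), ENNReal.ofReal (2 * (φ * tailConst n)) := by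
        refine Finset.sum_le_sum fun j _ => ?_
        calc _ ≤ (2 ^ (j + 1) : ℝ≥0∞) * ENNReal.ofReal (φ * tailConst n / (2 ^ j : ℕ)) := by
              gcongr
              exact measure_le_maxSteps_le hn hμ (by positivity)
          _ = _ := by
              rw [← ENNReal.ofReal_ofNat 2, ← ENNReal.ofReal_pow (by positivity),
                ← ENNReal.ofReal_mul (by positivity)]
              congr 1
              push_cast
              field_simp
              ring
    _ = _ := by
        rw [Finset.sum_const, Finset.card_range, nsmul_eq_mul, ← ENNReal.ofReal_natCast,
          ← ENNReal.ofReal_mul (by positivity)]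
        congr 1
        push_cast
        ring

/-- The probability that some implementation exceeds the step bound is at most `1 / n`. -/
theorem one_sub_le_measure_steps_le (hn : 1 ≤ n) (hφ : 0 < φ) (hμ : ∀ e, IsSmoothed φ (μ e)) :
    1 - ENNReal.ofReal (1 / n) ≤ Measure.pi μ {X : Weights n | ∀ A : Implementation n,
      ((A.steps X : ℕ∞) : ℝ≥0∞) ≤ ENNReal.ofReal (stepBound (67 * 4 ^ 11) φ n)} := by
  rcases eq_or_lt_of_le hn with rfl | hn2
  · simp
  have hprob : ∀ e, IsProbabilityMeasure (μ e) := fun e => (hμ e).1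
  set B := stepBound (67 * 4 ^ 11) φ n with hB
  have hn0 : (0 : ℝ) < n := by exact_mod_cast hn
  have hB0 : 0 ≤ B := by rw [hB, stepBound]; positivity
  set T := ⌊B⌋₊ + 1 with hT
  have hTB : B < T := by rw [hT]; exact_mod_cast Nat.lt_floor_add_one B
  have hT0 : (0 : ℝ) < T := lt_of_le_of_lt hB0 hTB
  have hsub : {X : Weights n | (T : ℕ∞) ≤ maxSteps X}ᶜ ⊆
      {X | ∀ A : Implementation n, ((A.steps X : ℕ∞) : ℝ≥0∞) ≤ ENNReal.ofReal B} := by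
    intro X hX A
    rw [Set.mem_compl_iff, Set.mem_ofPred_eq, not_le] at hX
    have hlt : A.steps X < T :=
      lt_of_le_of_lt (le_iSup (fun A : Implementation n => A.steps X) A) hX
    obtain ⟨M, hM⟩ := ENat.ne_top_iff_exists.1 hlt.ne_top
    rw [← hM, Nat.cast_lt] at hlt
    rw [← hM, ENat.toENNReal_coe, ← ENNReal.ofReal_natCast]
    refine ENNReal.ofReal_le_ofReal ?_
    exact (Nat.le_floor_iff hB0).1 (by omega)
  have htail := measure_le_maxSteps_le hn hμ (T := T) (by omega)
  have hle : φ * tailConst n / T ≤ 1 / n := by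
    rw [div_le_div_iff₀ hT0 hn0, one_mul]
    refine le_trans ?_ hTB.le
    rw [hB, stepBound, mul_assoc]
    refine mul_le_mul_of_nonneg_left (le_trans ?_ (tailConst_mul_le_rpow hn2)) hφ.le
    have h1 : (1 : ℝ) ≤ 4 * n := by
      have : (1 : ℝ) ≤ n := by exact_mod_cast hn
      linarith
    have h2 : (0 : ℝ) ≤ tailConst n := by positivity
    refine mul_le_mul_of_nonneg_right (le_mul_of_one_le_right h2 h1) hn0.le
  calc 1 - ENNReal.ofReal (1 / n) ≤ 1 - Measure.pi μ {X : Weights n | (T : ℕ∞) ≤ maxSteps X} :=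
        tsub_le_tsub_left (htail.trans (ENNReal.ofReal_le_ofReal hle)) 1
    _ = Measure.pi μ {X : Weights n | (T : ℕ∞) ≤ maxSteps X}ᶜ :=
        (prob_compl_eq_one_sub (measurableSet_le_maxSteps T)).symm
    _ ≤ _ := measure_mono hsub

theorem lintegral_maxSteps_le_stepBound (hn : 1 ≤ n) (hφ : 0 < φ) (hμ : ∀ e, IsSmoothed φ (μ e)) :
    ∫⁻ X, ((maxSteps X : ℕ∞) : ℝ≥0∞) ∂(Measure.pi μ) ≤
      ENNReal.ofReal (stepBound (67 * 4 ^ 11) φ n) := by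
  rcases eq_or_lt_of_le hn with rfl | hn2
  -- For `n = 1` the step bound is `φ`, which the tail bound does not give, but there are no steps.
  · simp [maxSteps_eq_zero]
  refine (lintegral_maxSteps_le hn hμ).trans (ENNReal.ofReal_le_ofReal ?_)
  rw [stepBound]
  refine mul_le_mul_of_nonneg_left (le_trans ?_ (tailConst_mul_le_rpow hn2)) hφ.le
  have h1 : (1 : ℝ) ≤ n := by exact_mod_cast hn
  exact le_mul_of_one_le_right (by positivity) h1

end SwapPartition

/-- The constant `C` and the failure probability `δ` (which tends to `0`) are universal. The
edge weights are independent, with joint law `Measure.pi μ`. -/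
theorem theorem1 :
    ∃ C : ℝ, 0 < C ∧ ∃ δ : ℕ → ℝ, Tendsto δ atTop (𝓝 0) ∧
      ∀ n : ℕ, 1 ≤ n → ∀ φ : ℝ, 0 < φ →
        ∀ μ : SwapPartition.Edge n → Measure ℝ, (∀ e, SwapPartition.IsSmoothed φ (μ e)) →
          Measurable (fun X : SwapPartition.Weights n =>
            ((SwapPartition.maxSteps X : ℕ∞) : ℝ≥0∞)) ∧
          1 - ENNReal.ofReal (δ n) ≤
            Measure.pi μ {X : SwapPartition.Weights n |
              ∀ A : SwapPartition.Implementation n,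
                ((A.steps X : ℕ∞) : ℝ≥0∞) ≤
                  ENNReal.ofReal (SwapPartition.stepBound C φ n)} ∧
          ∫⁻ X : SwapPartition.Weights n,
              ((SwapPartition.maxSteps X : ℕ∞) : ℝ≥0∞) ∂(Measure.pi μ) ≤
            ENNReal.ofReal (SwapPartition.stepBound C φ n) := by
  exact ⟨67 * 4 ^ 11, by norm_num, fun n => 1 / n, tendsto_one_div_atTop_nhds_zero_nat,
    fun _ hn _ hφ _ hμ => ⟨SwapPartition.measurable_maxSteps,
      SwapPartition.one_sub_le_measure_steps_le hn hφ hμ,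
      SwapPartition.lintegral_maxSteps_le_stepBound hn hφ hμ⟩⟩
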